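/- Let $p$ be a prime, let $\mathbb F_q$ be a finite field of order $q$ and characteristic $p$, and let $V$ be an $n$-dimensional vector space over $\mathbb F_q$. Let $Z$ be the group of all scalar transformations of $V$, and let $G$ be a $p$-solvable group with $Z \le G \le GL(V)$ (a finite group is $p$-solvable if it has a subnormal series each of whose factors is a $p$-group or a group of order not divisible by $p$). For $X \subseteq V$ let $N_G(X) = \{g \in G : g(x) \in X \text{ for all } x \in X\}$ be the setwise stabilizer of $X$ in $G$. (1) If $n = 2$ and $q \ge 5$, then at least one of the following holds. (a) There is a basis $x, y$ of $V$ such that $N_G(\langle x\rangle) \subseteq N_G(\langle y\rangle)$. (b) $p = 2$ and there is a basis $x, y$ of $V$ such that $N_G(\langle x\rangle) = Z \times C_2$ (the internal direct product of $Z$ and a subgroup of order $2$) and the involution $g$ in $N_G(\langle x\rangle)$ satisfies $g(x) = x$ and $g(y) = y + x$. (2) If $n = 3$ and $q = 3$ or $q = 4$, then at least one of the following holds. (a) There is a basis $x, y, z$ of $V$ such that $N_G(\langle x\rangle) \cap N_G(\langle y\rangle) \subseteq N_G(\langle z\rangle)$. (b) There is a basis $x, y, z$ of $V$ such that $N_G(\langle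 y, z\rangle) = G$. -/

import Mathlib

/-- A finite group `G` is `p`-solvable: it has a finite subnormal series
`1 = H 0 ≤ H 1 ≤ ... ≤ H m = G`, each term normal in the next one, every factor
`H (i + 1) / H i` of which is a `p`-group (its order is a power of `p`) or a `p'`-group
(its order is not divisible by `p`). -/
def IsPSolvable (p : ℕ) (G : Type*) [Group G] : Prop :=
  ∃ (m : ℕ) (H : ℕ → Subgroup G), H 0 = ⊥ ∧ H m = ⊤ ∧
    ∀ i < m, H i ≤ H (i + 1) ∧ ((H i).subgroupOf (H (i + 1))).Normal ∧
      ((∃ k : ℕ, (H i).relIndex (H (i + 1)) = p ^ k) ∨ ¬ p ∣ (H i).relIndex (H (i + 1)))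

/-- The group `Z` of scalar transformations of `V`. -/
def scalarGroup (F V : Type*) [Field F] [AddCommGroup V] [Module F V] :
    Subgroup (LinearMap.GeneralLinearGroup F V) :=
  (Units.map (algebraMap F (Module.End F V)).toMonoidHom).range

/-- `N_G(X)`, the setwise stabilizer in `G` of a subset `X` of the finite vector space `V`:
the elements `g ∈ G` with `g x ∈ X` for all `x ∈ X`. -/
def setStabilizer {F V : Type*} [Field F] [AddCommGroup V] [Module F V] [Finite V]
    (G : Subgroup (LinearMap.GeneralLinearGroup F V)) (X : Set V) :
    Subgroup (LinearMap.GeneralLinearGroup F V) where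
  carrier := {g | g ∈ G ∧ ∀ x ∈ X, (g : Module.End F V) x ∈ X}
  one_mem' := ⟨G.one_mem, fun x hx => by simpa using hx⟩
  mul_mem' := by
    rintro a b ⟨ha, ha'⟩ ⟨hb, hb'⟩
    exact ⟨G.mul_mem ha hb, fun x hx => by simpa using ha' _ (hb' x hx)⟩
  inv_mem' := by
    rintro a ⟨ha, ha'⟩
    refine ⟨G.inv_mem ha, fun x hx => ?_⟩
    have hinj : Function.Injective (a : Module.End F V) := by
      intro u v huv
      have h := congrArg ((a⁻¹ : LinearMap.GeneralLinearGroup F V) : Module.End F V) huv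
      rwa [← Module.End.mul_apply, ← Module.End.mul_apply, Units.inv_mul] at h
    have hsurj : Function.Surjective (Set.MapsTo.restrict (a : Module.End F V) X X ha') :=
      Finite.surjective_of_injective fun u v huv => Subtype.ext (hinj (congrArg Subtype.val huv))
    obtain ⟨⟨y, hy⟩, hyx⟩ := hsurj ⟨x, hx⟩
    have hyx' : (a : Module.End F V) y = x := congrArg Subtype.val hyx
    rw [← hyx', ← Module.End.mul_apply, Units.inv_mul]
    simpa using hy

/-- The subgroup `N` is the internal direct product of its subgroups `A` and `B`. -/
def IsInternalDirectProduct {Γ : Type*} [Group Γ] (N A B : Subgroup Γ) : Prop :=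
  (∀ a ∈ A, ∀ b ∈ B, Commute a b) ∧ A ⊓ B = ⊥ ∧ A ⊔ B = N

/-!
Both parts follow one pattern. Call an element of order `p` in `G` a transvection if it fixes a
hyperplane pointwise. If the first alternative fails, Maschke's theorem
(`exists_invariant_isCompl`) and Cauchy's theorem show that *every* hyperplane of `V` is the axis
of a transvection in `G`. Such a group is irreducible (in dimension three, once the
alternative of an invariant plane is excluded), so it has no nontrivial normal `p`-subgroup, and
`p`-solvability yields a noncentral normal subgroup `N` of order prime to `p`
(`IsPSolvable.exists_normal_not_le`, `exists_normal_not_dvd_card`). Transvections normalizing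
such an `N` are very restricted.

In dimension two, let `t` be a transvection and `n ∈ N`. The element `(t n) ^ |N|` has order `p`
and commutes with `t n`, so the characteristic polynomial of `t n` is a square
(`exists_smul_smul_eq_of_coset`). In the basis `x, n x`, where `t x = x` and
`t (n x) = n x + c x`, this reads `(τ + c)² = 4 d` with `τ` and `d` the trace and determinant of
`n`. The powers of `t` replace `c` by its multiples, so `p ≤ 3`. For `p = 2` the equation
determines `c`, so `x` is the center of exactly one transvection and its stabilizer is `Z × C₂`.
For `p = 3` all noncentral elements of `N` have trace `0`, and conjugates of one of them by
two suitable transvections have a product that violates this as soon as some scalar satisfies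
`c⁵ ≠ c`.

In dimension three, `N` is itself irreducible, by a Clifford argument
(`HasTransvections.irreducible_of_normal`). A prime `r` that divides `q³ - 1` but neither `q - 1`
nor `q² - 1` does not divide `|N|`: a transvection normalizes a Sylow `r`-subgroup of `N`, hence
its center, and a commutative irreducible group cannot be normalized by a transvection
(`false_of_commutative_irreducible`). This applies to `r = 13` for `q = 3` and to `r = 7` for
`q = 4`. Counting the `N`-orbits on the `13` or `21` points of the projective plane then gives an
orbit of length `1` or `3`; length `1` contradicts irreducibility. An orbit of length `3` spans
`V`, and the transvection whose axis contains two of its points preserves the orbit, so it fixes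
the third point, which lies off the axis (`HasTransvections.card_orbit_ne_three`).
-/

/-! ### Normal subgroups of `p`-solvable groups -/

/-- `N` is normalized by `H`, contained in `H`, and every prime divisor of its order
satisfies `π`; when `π` is a set of primes, `N` is a normal `π`-subgroup of `H`. -/
def IsNormalPiSubgroup {Γ : Type*} [Group Γ] (π : ℕ → Prop) (H N : Subgroup Γ) : Prop :=
  N ≤ H ∧ H ≤ Subgroup.normalizer (N : Set Γ) ∧ ∀ r : ℕ, r.Prime → r ∣ Nat.card N → π r

theorem Subgroup.card_sup_dvd_of_le_normalizer {Γ : Type*} [Group Γ]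
    {A B : Subgroup Γ} (h : A ≤ Subgroup.normalizer (B : Set Γ)) :
    Nat.card (A ⊔ B : Subgroup Γ) ∣ Nat.card A * Nat.card B := by
  have hn : (B.subgroupOf (A ⊔ B)).Normal :=
    (Subgroup.normal_subgroupOf_iff_le_normalizer le_sup_right).2
      (sup_le h Subgroup.le_normalizer)
  have h1 : B.relIndex (A ⊔ B) = B.relIndex A := by
    have h2 := Subgroup.relIndex_sup_right (A.subgroupOf (A ⊔ B)) (B.subgroupOf (A ⊔ B))
    rwa [← Subgroup.subgroupOf_sup le_sup_left le_sup_right,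
      Subgroup.relIndex_subgroupOf le_rfl, Subgroup.relIndex_subgroupOf le_sup_left] at h2
  rw [← Subgroup.relIndex_bot_left (A ⊔ B), ← Subgroup.relIndex_mul_relIndex ⊥ B (A ⊔ B) bot_le
    le_sup_right, h1, Subgroup.relIndex_bot_left, mul_comm]
  exact mul_dvd_mul (Subgroup.relIndex_dvd_card _ _) dvd_rfl

theorem IsNormalPiSubgroup.sup {Γ : Type*} [Group Γ] {π : ℕ → Prop} {H A B : Subgroup Γ}
    (hA : IsNormalPiSubgroup π H A) (hB : IsNormalPiSubgroup π H B) :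
    IsNormalPiSubgroup π H (A ⊔ B) := by
  refine ⟨sup_le hA.1 hB.1, fun g hg => ?_, fun r hr hd => ?_⟩
  · rw [Subgroup.mem_normalizer_iff_map_conj_eq, Subgroup.map_sup,
      Subgroup.mem_normalizer_iff_map_conj_eq.1 (hA.2.1 hg),
      Subgroup.mem_normalizer_iff_map_conj_eq.1 (hB.2.1 hg)]
  · rcases hr.dvd_mul.1
      (hd.trans (Subgroup.card_sup_dvd_of_le_normalizer (hA.1.trans hB.2.1))) with h | h
    · exact hA.2.2 r hr h
    · exact hB.2.2 r hr h

theorem exists_isGreatest_isNormalPiSubgroup {Γ : Type*} [Group Γ] [Finite Γ] (π : ℕ → Prop)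
    (H : Subgroup Γ) : ∃ R, IsGreatest {N | IsNormalPiSubgroup π H N} R := by
  have hne : {N | IsNormalPiSubgroup π H N}.Nonempty := by
    refine ⟨⊥, bot_le, ?_, fun r hr hd => ?_⟩
    · rw [Subgroup.normalizer_eq_top]; exact le_top
    · rw [Subgroup.card_bot, Nat.dvd_one] at hd
      exact absurd hd hr.one_lt.ne'
  obtain ⟨R, hR⟩ := (Set.toFinite {N | IsNormalPiSubgroup π H N}).exists_maximal hne
  refine ⟨R, hR.1, fun M hM => ?_⟩
  exact le_sup_right.trans (hR.2 (IsNormalPiSubgroup.sup hR.1 hM) le_sup_left)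

/-- The largest normal `π`-subgroup is characteristic, hence it can only grow along a
subnormal series. -/
theorem IsNormalPiSubgroup.exists_of_normal {Γ : Type*} [Group Γ] [Finite Γ] {π : ℕ → Prop}
    {H L K : Subgroup Γ} (hHL : H ≤ L) (hn : L ≤ Subgroup.normalizer (H : Set Γ))
    (hK : IsNormalPiSubgroup π H K) : ∃ N, IsNormalPiSubgroup π L N ∧ K ≤ N := by
  obtain ⟨R, hR, hmax⟩ := exists_isGreatest_isNormalPiSubgroup π H
  have key : ∀ g ∈ L, R.map (MulAut.conj g).toMonoidHom ≤ R := by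
    intro g hg
    have hgH := Subgroup.mem_normalizer_iff_map_conj_eq.1 (hn hg)
    refine hmax ⟨?_, ?_, fun r hr hd => ?_⟩
    · exact (Subgroup.map_mono hR.1).trans hgH.le
    · calc H = H.map (MulAut.conj g).toMonoidHom := hgH.symm
        _ ≤ _ := Subgroup.map_mono hR.2.1
        _ ≤ _ := Subgroup.le_normalizer_map _
    · refine hR.2.2 r hr ?_
      rwa [Subgroup.card_map_of_injective (MulAut.conj g).injective] at hd
  refine ⟨R, ⟨hR.1.trans hHL, ?_, hR.2.2⟩, hmax hK⟩
  rw [Subgroup.le_normalizer_iff]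
  exact fun g hg k hk => key g hg ⟨k, hk, rfl⟩

theorem IsNormalPiSubgroup.exists_of_series {Γ : Type*} [Group Γ] [Finite Γ] {π : ℕ → Prop}
    {m : ℕ} {H : ℕ → Subgroup Γ} (hle : ∀ i < m, H i ≤ H (i + 1))
    (hn : ∀ i < m, H (i + 1) ≤ Subgroup.normalizer (H i : Set Γ)) {j : ℕ} (hj : j ≤ m)
    {K : Subgroup Γ} (hK : IsNormalPiSubgroup π (H j) K) :
    ∃ N, IsNormalPiSubgroup π (H m) N ∧ K ≤ N := by
  induction m, hj using Nat.le_induction with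
  | base => exact ⟨K, hK, le_rfl⟩
  | succ m hm ih =>
    obtain ⟨N, hN, hKN⟩ := ih (fun i hi => hle i (by omega)) (fun i hi => hn i (by omega))
    obtain ⟨N', hN', h⟩ := hN.exists_of_normal (hle m (by omega)) (hn m (by omega))
    exact ⟨N', hN', hKN.trans h⟩

/-- A central subgroup of order prime to `p` and `p`-power index has a normal complement. -/
theorem exists_normal_pGroup_sup_eq_top {K : Type*} [Group K] [Finite K] {p k : ℕ}
    [Fact p.Prime] (A : Subgroup K) (hA : A ≤ Subgroup.center K) (hpA : ¬ p ∣ Nat.card A)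
    (hk : A.index = p ^ k) :
    ∃ P : Subgroup K, P.Normal ∧ Nat.card P = p ^ k ∧ A ⊔ P = ⊤ := by
  have hAn : A.Normal := ⟨fun a ha g => by
    rw [Subgroup.mem_center_iff.1 (hA ha) g]; simpa using ha⟩
  obtain ⟨P, hP⟩ := Subgroup.exists_right_complement'_of_coprime (N := A) (by
    rw [hk]
    exact ((Nat.Prime.coprime_iff_not_dvd Fact.out).2 hpA).symm.pow_right k)
  refine ⟨P, ?_, ?_, hP.sup_eq_top⟩
  · rw [← Subgroup.normalizer_eq_top_iff, eq_top_iff, ← hP.sup_eq_top]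
    refine sup_le ?_ Subgroup.le_normalizer
    rw [Subgroup.le_normalizer_iff]
    intro a ha x hx
    rw [← Subgroup.mem_center_iff.1 (hA ha) x]
    simpa using hx
  · have := hP.symm.index_eq_card
    rw [← this, hk]

/-- In a `p`-solvable group with a proper central subgroup `Z` of order prime to `p`, the
first term of the series that is not inside `Z` yields a normal subgroup outside `Z` that is
a `p`-group or has order prime to `p`. -/
theorem IsPSolvable.exists_normal_not_le {Γ : Type*} [Group Γ] [Finite Γ] {p : ℕ}
    [Fact p.Prime] (h : IsPSolvable p Γ) {Z : Subgroup Γ} (hZ : Z ≤ Subgroup.center Γ)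
    (hpZ : ¬ p ∣ Nat.card Z) (hZt : Z ≠ ⊤) :
    ∃ N : Subgroup Γ, N.Normal ∧ ¬ N ≤ Z ∧ (¬ p ∣ Nat.card N ∨ IsPGroup p N) := by
  obtain ⟨m, H, h0, hm, hH⟩ := h
  have hle : ∀ i < m, H i ≤ H (i + 1) := fun i hi => (hH i hi).1
  have hn : ∀ i < m, H (i + 1) ≤ Subgroup.normalizer (H i : Set Γ) := fun i hi =>
    (Subgroup.normal_subgroupOf_iff_le_normalizer (hle i hi)).1 (hH i hi).2.1
  have hp : p.Prime := Fact.out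
  have lift : ∀ (π : ℕ → Prop) (j : ℕ), j ≤ m → ∀ K, IsNormalPiSubgroup π (H j) K → ¬ K ≤ Z →
      ∃ N : Subgroup Γ, N.Normal ∧ ¬ N ≤ Z ∧ ∀ r : ℕ, r.Prime → r ∣ Nat.card N → π r := by
    intro π j hj K hK hKZ
    obtain ⟨N, hN, hKN⟩ := hK.exists_of_series hle hn hj
    refine ⟨N, ?_, fun h => hKZ (hKN.trans h), hN.2.2⟩
    rw [← Subgroup.normalizer_eq_top_iff, eq_top_iff, ← hm]
    exact hN.2.1
  have hex : ∃ j, ¬ H j ≤ Z := ⟨m, by rw [hm, top_le_iff]; exact hZt⟩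
  classical
  obtain ⟨i, hi⟩ : ∃ i, Nat.find hex = i + 1 := by
    refine Nat.exists_eq_succ_of_ne_zero fun h => ?_
    have := Nat.find_spec hex
    rw [h, h0] at this
    exact this bot_le
  have hj := Nat.find_spec hex
  have him : i < m := by
    have : Nat.find hex ≤ m := Nat.find_min' hex (by rw [hm, top_le_iff]; exact hZt)
    omega
  have hiZ : H i ≤ Z := not_not.1 (Nat.find_min hex (by omega : i < Nat.find hex))
  rw [hi] at hj
  have hpi : ¬ p ∣ Nat.card (H i) := fun h => hpZ (h.trans (Subgroup.card_dvd_of_le hiZ))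
  rcases (hH i him).2.2 with ⟨k, hk⟩ | hk
  · obtain ⟨P, hPn, hPc, hPs⟩ := exists_normal_pGroup_sup_eq_top
      (p := p) (k := k) ((H i).subgroupOf (H (i + 1)))
      (fun a ha => Subgroup.mem_center_iff.2 fun g =>
        Subtype.ext (Subgroup.mem_center_iff.1 (hZ (hiZ ha)) g))
      (by rwa [Nat.card_congr (Subgroup.subgroupOfEquivOfLe (hle i him)).toEquiv]) hk
    have hmap : H i ⊔ P.map (H (i + 1)).subtype = H (i + 1) := by
      have := congrArg (Subgroup.map (H (i + 1)).subtype) hPs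
      rwa [Subgroup.map_sup, Subgroup.map_subgroupOf_eq_of_le (hle i him),
        ← MonoidHom.range_eq_map, Subgroup.range_subtype] at this
    obtain ⟨N, hN, hNZ, hr⟩ := lift (fun r => r = p) (i + 1) him (P.map (H (i + 1)).subtype)
      ⟨Subgroup.map_subtype_le _, by
        rw [Subgroup.le_normalizer_iff]
        rintro g hg _ ⟨x, hx, rfl⟩
        exact ⟨_, hPn.conj_mem x hx ⟨g, hg⟩, rfl⟩, fun r hr hd => by
        rw [Subgroup.card_map_of_injective (Subgroup.subtype_injective _), hPc] at hd
        exact (Nat.prime_dvd_prime_iff_eq hr hp).1 (hr.dvd_of_dvd_pow hd)⟩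
      (fun h => hj (hmap ▸ sup_le hiZ h))
    refine ⟨N, hN, hNZ, Or.inr ?_⟩
    rw [IsPGroup.iff_card]
    exact ⟨_, Nat.eq_prime_pow_of_unique_prime_dvd Nat.card_pos.ne' fun {d} hd => hr d hd⟩
  · obtain ⟨N, hN, hNZ, hr⟩ := lift (fun r => r ≠ p) (i + 1) him (H (i + 1))
      ⟨le_rfl, Subgroup.le_normalizer, fun r hr hd hrp => by
        subst hrp
        rw [← Subgroup.relIndex_bot_left, ← Subgroup.relIndex_mul_relIndex ⊥ (H i) (H (i + 1))
          bot_le (hle i him), Subgroup.relIndex_bot_left] at hd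
        exact (hr.dvd_mul.1 hd).elim hpi hk⟩ hj
    exact ⟨N, hN, hNZ, Or.inl fun h => hr p hp h rfl⟩

section LinearGroups

open LinearMap

variable {F V : Type*} [Field F] [AddCommGroup V] [Module F V]

/-! ### Scalars, stabilizers of lines and planes, invariant complements -/

instance finite_generalLinearGroup [Finite V] : Finite (GeneralLinearGroup F V) := by
  have : Finite (Module.End F V) := Finite.of_injective _ DFunLike.coe_injective
  exact Finite.of_injective _ Units.val_injective

theorem coe_apply_eq_smul (g : GeneralLinearGroup F V) (v : V) :
    (g : Module.End F V) v = g • v := rfl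

theorem generalLinearGroup_ext {g h : GeneralLinearGroup F V} (H : ∀ v : V, g • v = h • v) :
    g = h := Units.ext (LinearMap.ext H)

theorem mem_scalarGroup {g : GeneralLinearGroup F V} :
    g ∈ scalarGroup F V ↔ ∃ a : Fˣ, ∀ v : V, g • v = a • v := by
  constructor
  · rintro ⟨a, rfl⟩
    exact ⟨a, fun v => rfl⟩
  · rintro ⟨a, ha⟩
    exact ⟨a, generalLinearGroup_ext fun v => (ha v).symm⟩

theorem mem_scalarGroup_of_forall [Nontrivial V] {g : GeneralLinearGroup F V} {a : F}
    (h : ∀ v : V, g • v = a • v) : g ∈ scalarGroup F V := by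
  obtain ⟨v, hv⟩ := exists_ne (0 : V)
  have ha : a ≠ 0 := by
    rintro rfl
    exact hv (by simpa [zero_smul, smul_eq_zero_iff_eq] using h v)
  exact mem_scalarGroup.2 ⟨Units.mk0 a ha, h⟩

/-- A linear map for which every vector is an eigenvector is a scalar. -/
theorem exists_forall_smul_ne [Nontrivial V] {g : GeneralLinearGroup F V}
    (hg : g ∉ scalarGroup F V) : ∃ x : V, ∀ a : F, g • x ≠ a • x := by
  by_contra! H
  choose a ha using H
  obtain ⟨v, hv⟩ := exists_ne (0 : V)
  refine hg (mem_scalarGroup_of_forall (a := a v) fun w => ?_)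
  by_cases hw : w ∈ F ∙ v
  · obtain ⟨c, rfl⟩ := Submodule.mem_span_singleton.1 hw
    rw [smul_comm g c v, ha v, smul_comm]
  · have hind : LinearIndependent F ![v, w] := by
      rw [LinearIndependent.pair_iff' hv]
      exact fun c hc => hw (Submodule.mem_span_singleton.2 ⟨c, hc⟩)
    have h1 : (a (v + w) - a v) • v + (a (v + w) - a w) • w = 0 := by
      have h2 : a (v + w) • (v + w) = a v • v + a w • w := by
        rw [← ha, ← ha v, ← ha w, smul_add]
      rw [smul_add] at h2
      rw [sub_smul, sub_smul, ← sub_eq_zero.2 h2]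
      abel
    obtain ⟨h3, h4⟩ := LinearIndependent.pair_iff.1 hind _ _ h1
    rw [ha w, ← sub_eq_zero.1 h4, ← sub_eq_zero.1 h3]

theorem scalarGroup_mul_comm {z : GeneralLinearGroup F V} (hz : z ∈ scalarGroup F V)
    (g : GeneralLinearGroup F V) : g * z = z * g := by
  obtain ⟨a, ha⟩ := mem_scalarGroup.1 hz
  exact generalLinearGroup_ext fun v => by rw [mul_smul, mul_smul, ha, ha, smul_comm]

theorem smul_mem_of_scalarGroup {z : GeneralLinearGroup F V} (hz : z ∈ scalarGroup F V)
    (U : Submodule F V) {u : V} (hu : u ∈ U) : z • u ∈ U := by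
  obtain ⟨a, ha⟩ := mem_scalarGroup.1 hz
  rw [ha]
  exact U.smul_mem (a : F) hu

theorem not_dvd_card_scalarGroup [Finite F] (p : ℕ) [CharP F p] :
    ¬ p ∣ Nat.card (scalarGroup F V) := by
  intro h
  have hp : p.Prime := CharP.char_is_prime F p
  have h1 : p ∣ Nat.card F - 1 := by
    rw [← Nat.card_units]
    exact h.trans (Subgroup.card_range_dvd _)
  have h2 : p ∣ Nat.card F := by
    have := Fintype.ofFinite F
    rw [← CharP.cast_eq_zero_iff F p, Nat.card_eq_fintype_card, FiniteField.cast_card_eq_zero]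
  exact hp.one_lt.ne' (Nat.dvd_one.1 ((Nat.dvd_sub_iff_right
    (Nat.one_le_iff_ne_zero.2 Nat.card_pos.ne') h2).1 h1))

theorem mem_setStabilizer_span_singleton [Finite V] {G : Subgroup (GeneralLinearGroup F V)}
    {x : V} {g : GeneralLinearGroup F V} :
    g ∈ setStabilizer G (Submodule.span F {x} : Set V) ↔ g ∈ G ∧ ∃ a : F, g • x = a • x := by
  refine and_congr_right fun _ => ⟨fun h => ?_, ?_⟩
  · obtain ⟨a, ha⟩ := Submodule.mem_span_singleton.1 (h x (Submodule.mem_span_singleton_self x))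
    exact ⟨a, ha.symm⟩
  · rintro ⟨a, ha⟩ y hy
    obtain ⟨c, rfl⟩ := Submodule.mem_span_singleton.1 hy
    rw [coe_apply_eq_smul, smul_comm, ha]
    exact Submodule.smul_mem _ _ (Submodule.smul_mem _ _ (Submodule.mem_span_singleton_self x))

/-- Maschke's theorem for a linear group of order prime to the characteristic: average a
projection over the group. -/
theorem exists_invariant_isCompl [Finite V] (p : ℕ) [CharP F p]
    {D : Subgroup (GeneralLinearGroup F V)} (hD : ¬ p ∣ Nat.card D) (U : Submodule F V)
    (hU : ∀ g ∈ D, ∀ u ∈ U, g • u ∈ U) :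
    ∃ U' : Submodule F V, IsCompl U U' ∧ ∀ g ∈ D, ∀ u ∈ U', g • u ∈ U' := by
  have := Fintype.ofFinite D
  obtain ⟨pr, hpr⟩ := U.subtype.exists_leftInverse_of_injective U.ker_subtype
  have hpr' : ∀ u (hu : u ∈ U), (pr u : V) = u := fun u hu =>
    congrArg Subtype.val (LinearMap.congr_fun hpr ⟨u, hu⟩)
  have hc : (Nat.card D : F) ≠ 0 := by rwa [Ne, CharP.cast_eq_zero_iff F p]
  let f : V →ₗ[F] V := (Nat.card D : F)⁻¹ •
    ∑ g : D, (g : GeneralLinearGroup F V).val ∘ₗ U.subtype ∘ₗ pr ∘ₗ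
      ((g⁻¹ : D) : GeneralLinearGroup F V).val
  have hf : ∀ v, f v = (Nat.card D : F)⁻¹ • ∑ g : D, g • (pr (g⁻¹ • v) : V) := by
    intro v
    simp only [f, LinearMap.smul_apply, LinearMap.sum_apply]
    rfl
  have hfU : ∀ v, f v ∈ U := fun v => by
    rw [hf]
    exact U.smul_mem _ (U.sum_mem fun g _ => hU g g.2 _ (pr _).2)
  have hfid : ∀ u ∈ U, f u = u := fun u hu => by
    have : ∀ g : D, g • (pr (g⁻¹ • u) : V) = u := fun g => by
      rw [hpr' (g⁻¹ • u) (hU _ (g⁻¹).2 u hu), smul_inv_smul]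
    rw [hf, Finset.sum_congr rfl fun g _ => this g, Finset.sum_const, Finset.card_univ,
      ← Nat.card_eq_fintype_card, ← Nat.cast_smul_eq_nsmul F, smul_smul, inv_mul_cancel₀ hc,
      one_smul]
  have hfeq : ∀ h : D, ∀ v, f (h • v) = h • f v := fun h v => by
    rw [hf, hf, smul_comm h (Nat.card D : F)⁻¹, Finset.smul_sum (r := h)]
    congr 1
    refine Fintype.sum_equiv (Equiv.mulLeft h⁻¹) _ _ fun g => ?_
    simp only [Equiv.coe_mulLeft, mul_inv_rev, inv_inv, mul_smul, smul_inv_smul]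
  refine ⟨LinearMap.ker (f.codRestrict U hfU), LinearMap.isCompl_of_proj fun u =>
    Subtype.ext (hfid u u.2), fun g hg u hu => ?_⟩
  rw [LinearMap.ker_codRestrict, LinearMap.mem_ker] at hu ⊢
  have := hfeq ⟨g, hg⟩ u
  rw [hu, smul_zero] at this
  exact this

/-! ### Elements of order `p` in characteristic `p` -/

theorem eq_one_of_pow_char_eq_one (p : ℕ) [Fact p.Prime] [CharP F p] {a : F} (h : a ^ p = 1) :
    a = 1 := by
  have h1 := sub_pow_char (p := p) a 1
  rw [h, one_pow, sub_self] at h1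
  exact sub_eq_zero.1 (pow_eq_zero_iff (Fact.out : p.Prime).ne_zero |>.1 h1)

/-- The eigenvalues of an element of order dividing `p` on `V ⧸ W` are trivial. -/
theorem eigenvalue_eq_one_of_pow_char (p : ℕ) [Fact p.Prime] [CharP F p]
    {t : GeneralLinearGroup F V} (ht : t ^ p = 1) (W : Submodule F V)
    (hW : ∀ w ∈ W, t • w ∈ W) {u : V} (hu : u ∉ W) {a : F} (ha : t • u - a • u ∈ W) : a = 1 := by
  have key : ∀ k : ℕ, t ^ k • u - a ^ k • u ∈ W := by
    intro k
    induction k with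
    | zero => simp
    | succ k ih =>
      have h1 : t ^ (k + 1) • u - a ^ (k + 1) • u =
          t • (t ^ k • u - a ^ k • u) + a ^ k • (t • u - a • u) := by
        rw [pow_succ', mul_smul, smul_sub, smul_sub, pow_succ, mul_smul, smul_comm t (a ^ k)]
        abel
      rw [h1]
      exact W.add_mem (hW _ ih) (W.smul_mem _ ha)
  have h := key p
  rw [ht, one_smul] at h
  have h2 : (1 - a ^ p) • u ∈ W := by rwa [sub_smul, one_smul]
  have h3 : 1 - a ^ p = 0 := by
    by_contra h0
    exact hu ((W.smul_mem_iff h0).1 h2)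
  exact eq_one_of_pow_char_eq_one p (sub_eq_zero.1 h3).symm

theorem smul_eq_self_of_pow_char (p : ℕ) [Fact p.Prime] [CharP F p]
    {t : GeneralLinearGroup F V} (ht : t ^ p = 1) {x : V} {a : F}
    (h : t • x = a • x) : t • x = x := by
  by_cases hx : x = 0
  · rw [hx, smul_zero]
  · have : a = 1 := eigenvalue_eq_one_of_pow_char p ht ⊥ (fun w hw => by
      rw [(Submodule.mem_bot F).1 hw, smul_zero]; exact Submodule.zero_mem _)
      (u := x) (by rwa [Submodule.mem_bot]) (by rw [h, sub_self]; exact Submodule.zero_mem _)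
    rw [h, this, one_smul]

theorem exists_pow_char_eq_one_of_dvd {Γ : Type*} [Group Γ] [Finite Γ] {p : ℕ} [Fact p.Prime]
    {D : Subgroup Γ} (h : p ∣ Nat.card D) : ∃ t ∈ D, t ≠ 1 ∧ t ^ p = 1 := by
  obtain ⟨t, ht⟩ := exists_prime_orderOf_dvd_card' p h
  refine ⟨t, t.2, fun h1 => ?_, ?_⟩
  · have : t = 1 := Subtype.ext h1
    rw [this, orderOf_one] at ht
    exact (Fact.out : p.Prime).one_lt.ne ht
  · have := pow_orderOf_eq_one t
    rw [ht] at this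
    exact congrArg Subtype.val this

theorem exists_fixed_vector_of_isPGroup [Finite V] [Nontrivial V] (p : ℕ) [Fact p.Prime]
    [CharP F p] {Q : Subgroup (GeneralLinearGroup F V)} (hQ : IsPGroup p Q) :
    ∃ v : V, v ≠ 0 ∧ ∀ n ∈ Q, n • v = v := by
  have hpV : p ∣ Nat.card V := by
    obtain ⟨v, hv⟩ := exists_ne (0 : V)
    have h1 : addOrderOf v = p := by
      refine addOrderOf_eq_prime ?_ hv
      rw [← Nat.cast_smul_eq_nsmul F, CharP.cast_eq_zero, zero_smul]
    exact h1 ▸ addOrderOf_dvd_natCard v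
  obtain ⟨b, hb, hb0⟩ := hQ.exists_fixed_point_of_prime_dvd_card_of_fixed_point V hpV
    (a := (0 : V)) (fun n => smul_zero n)
  exact ⟨b, hb0.symm, fun n hn => hb ⟨n, hn⟩⟩

/-- The subspace of vectors fixed by every element of `Q`. -/
def fixedVectors (Q : Subgroup (GeneralLinearGroup F V)) : Submodule F V where
  carrier := {v | ∀ n ∈ Q, n • v = v}
  add_mem' := fun {a b} ha hb n hn => by rw [smul_add, ha n hn, hb n hn]
  zero_mem' := fun n _ => smul_zero n
  smul_mem' := fun c v hv n hn => by rw [smul_comm, hv n hn]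

/-! ### Irreducible `p`-solvable groups -/

/-- An irreducible linear group has no nontrivial normal `p`-subgroup in characteristic `p`:
the fixed vectors of such a subgroup would form a nonzero invariant subspace. -/
theorem eq_one_of_isPGroup_of_irreducible [Finite V] [Nontrivial V] (p : ℕ) [Fact p.Prime]
    [CharP F p] {G Q : Subgroup (GeneralLinearGroup F V)}
    (hirr : ∀ U : Submodule F V, (∀ g ∈ G, ∀ u ∈ U, g • u ∈ U) → U = ⊥ ∨ U = ⊤)
    (hQn : ∀ g ∈ G, ∀ n ∈ Q, g * n * g⁻¹ ∈ Q) (hQ : IsPGroup p Q) :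
    ∀ n ∈ Q, n = 1 := by
  have hUG : ∀ g ∈ G, ∀ u ∈ fixedVectors Q, g • u ∈ fixedVectors Q := by
    intro g hg u hu n hn
    have h1 : (g⁻¹ * n * g⁻¹⁻¹) • u = u := hu _ (hQn g⁻¹ (G.inv_mem hg) n hn)
    rw [inv_inv, mul_smul, mul_smul, inv_smul_eq_iff] at h1
    exact h1
  obtain ⟨b, hb0, hb⟩ := exists_fixed_vector_of_isPGroup (V := V) p hQ
  have hbU : b ∈ fixedVectors Q := hb
  rcases hirr (fixedVectors Q) hUG with h | h
  · rw [h, Submodule.mem_bot] at hbU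
    exact absurd hbU hb0
  · intro n hn
    refine generalLinearGroup_ext fun v => ?_
    have : v ∈ fixedVectors Q := h ▸ Submodule.mem_top
    rw [this n hn, one_smul]

/-- An irreducible `p`-solvable linear group `G` containing the scalars has a noncentral normal
subgroup of order prime to `p` containing the scalars. -/
theorem exists_normal_not_dvd_card [Finite F] [Finite V] [Nontrivial V] (p : ℕ) [Fact p.Prime]
    [CharP F p] {G : Subgroup (GeneralLinearGroup F V)} (hZG : scalarGroup F V ≤ G)
    (hG : IsPSolvable p G) (hGZ : ¬ G ≤ scalarGroup F V)
    (hirr : ∀ U : Submodule F V, (∀ g ∈ G, ∀ u ∈ U, g • u ∈ U) → U = ⊥ ∨ U = ⊤) :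
    ∃ N : Subgroup (GeneralLinearGroup F V), N ≤ G ∧ scalarGroup F V ≤ N ∧
      (∀ g ∈ G, ∀ n ∈ N, g * n * g⁻¹ ∈ N) ∧ ¬ N ≤ scalarGroup F V ∧ ¬ p ∣ Nat.card N := by
  have hp : p.Prime := Fact.out
  have hZc : (scalarGroup F V).subgroupOf G ≤ Subgroup.center G := fun z hz =>
    Subgroup.mem_center_iff.2 fun g => Subtype.ext (scalarGroup_mul_comm hz g)
  obtain ⟨N, hN, hNZ, h⟩ := hG.exists_normal_not_le hZc
    (by
      rw [Nat.card_congr (Subgroup.subgroupOfEquivOfLe hZG).toEquiv]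
      exact not_dvd_card_scalarGroup p)
    (by rwa [Ne, Subgroup.subgroupOf_eq_top])
  have hNn : ∀ g ∈ G, ∀ n ∈ N.map G.subtype, g * n * g⁻¹ ∈ N.map G.subtype := by
    rintro g hg _ ⟨n, hn, rfl⟩
    exact ⟨_, hN.conj_mem n hn ⟨g, hg⟩, rfl⟩
  have hNZ' : ¬ N.map G.subtype ≤ scalarGroup F V := fun h =>
    hNZ fun n hn => h ⟨n, hn, rfl⟩
  have hcard : Nat.card (N.map G.subtype) = Nat.card N :=
    Subgroup.card_map_of_injective (Subgroup.subtype_injective _)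
  rcases h with h | h
  · refine ⟨N.map G.subtype ⊔ scalarGroup F V, sup_le (Subgroup.map_subtype_le _) hZG,
      le_sup_right, fun g hg n hn => ?_, fun h' => hNZ' (le_sup_left.trans h'), fun hd => ?_⟩
    · have hZn : ∀ g : GeneralLinearGroup F V, ∀ z ∈ scalarGroup F V,
          g * z * g⁻¹ ∈ scalarGroup F V := fun g z hz => by
        rw [scalarGroup_mul_comm hz g, mul_inv_cancel_right]
        exact hz
      have hle : (N.map G.subtype ⊔ scalarGroup F V).map (MulAut.conj g).toMonoidHom ≤
          N.map G.subtype ⊔ scalarGroup F V := by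
        rw [Subgroup.map_sup]
        refine sup_le_sup ?_ ?_
        · rintro _ ⟨x, hx, rfl⟩
          exact hNn g hg x hx
        · rintro _ ⟨x, hx, rfl⟩
          exact hZn g x hx
      exact hle ⟨n, hn, rfl⟩
    · have := hd.trans (Subgroup.card_sup_dvd_of_le_normalizer (Subgroup.le_normalizer_iff.2
        fun n hn z hz => by
          rw [scalarGroup_mul_comm hz n, mul_inv_cancel_right]
          exact hz))
      rw [hcard] at this
      exact (hp.dvd_mul.1 this).elim h (not_dvd_card_scalarGroup p)
  · refine absurd (fun n hn => ?_) hNZ'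
    rw [eq_one_of_isPGroup_of_irreducible p hirr hNn (h.map _) n hn]
    exact Subgroup.one_mem _

/-! ### Dimension two: elements of order `p` -/

theorem coeff_eq_of_pair {x y : V} (h : LinearIndependent F ![x, y]) {a b c d : F}
    (he : a • x + b • y = c • x + d • y) : a = c ∧ b = d := by
  have h1 : (a - c) • x + (b - d) • y = 0 := by
    linear_combination (norm := module) he
  obtain ⟨h2, h3⟩ := LinearIndependent.pair_iff.1 h _ _ h1
  exact ⟨sub_eq_zero.1 h2, sub_eq_zero.1 h3⟩

theorem exists_basis_of_pair (hV : Module.finrank F V = 2) {x y : V}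
    (h : LinearIndependent F ![x, y]) : ∃ b : Module.Basis (Fin 2) F V, b 0 = x ∧ b 1 = y :=
  ⟨basisOfLinearIndependentOfCardEqFinrank h (by simp [hV]), by simp, by simp⟩

theorem exists_coeff_of_pair (hV : Module.finrank F V = 2) {x y : V}
    (h : LinearIndependent F ![x, y]) (v : V) : ∃ a b : F, v = a • x + b • y := by
  obtain ⟨b, rfl, rfl⟩ := exists_basis_of_pair hV h
  exact ⟨b.repr v 0, b.repr v 1, by
    conv_lhs => rw [← b.sum_repr v, Fin.sum_univ_two]⟩

theorem linearIndependent_pair_of_notMem {x y : V} {U : Submodule F V} (hx : x ∈ U)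
    (hx0 : x ≠ 0) (hy : y ∉ U) : LinearIndependent F ![x, y] := by
  rw [LinearIndependent.pair_iff' hx0]
  rintro a rfl
  exact hy (U.smul_mem a hx)

theorem exists_linearIndependent_pair (hV : Module.finrank F V = 2) {x : V} (hx : x ≠ 0) :
    ∃ y, LinearIndependent F ![x, y] := by
  by_contra! H
  have : (⊤ : Submodule F V) ≤ F ∙ x := by
    intro y _
    by_contra hy
    exact H y (linearIndependent_pair_of_notMem (Submodule.mem_span_singleton_self x) hx hy)
  have h1 := finrank_span_singleton (K := F) hx
  rw [top_le_iff.1 this, finrank_top, hV] at h1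
  omega

/-- If no stabilizer of a line fixes a second line, then by Maschke's theorem and Cauchy's
theorem every vector is fixed by an element of order `p`. -/
theorem exists_pow_char_eq_one_fixing_vector [Finite V] (hV : Module.finrank F V = 2) (p : ℕ)
    [Fact p.Prime] [CharP F p] {G : Subgroup (GeneralLinearGroup F V)}
    (hG : ∀ b : Module.Basis (Fin 2) F V, ¬ setStabilizer G (Submodule.span F {b 0} : Set V) ≤
          setStabilizer G (Submodule.span F {b 1} : Set V)) {x : V} (hx : x ≠ 0) :
    ∃ t ∈ G, t ≠ 1 ∧ t ^ p = 1 ∧ t • x = x := by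
  by_cases hd : p ∣ Nat.card (setStabilizer G (Submodule.span F {x} : Set V))
  · obtain ⟨t, ht, ht1, htp⟩ := exists_pow_char_eq_one_of_dvd hd
    obtain ⟨htG, a, ha⟩ := mem_setStabilizer_span_singleton.1 ht
    exact ⟨t, htG, ht1, htp, smul_eq_self_of_pow_char p htp ha⟩
  · exfalso
    obtain ⟨U, hU, hUD⟩ := exists_invariant_isCompl p hd (F ∙ x) fun g hg u hu => hg.2 u hu
    obtain ⟨z, hz⟩ := exists_linearIndependent_pair hV hx
    have hUb : U ≠ ⊥ := by
      rintro rfl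
      have h1 : z ∈ F ∙ x := (eq_top_of_isCompl_bot hU) ▸ Submodule.mem_top
      obtain ⟨a, ha⟩ := Submodule.mem_span_singleton.1 h1
      exact (LinearIndependent.pair_iff' hx).1 hz a ha
    obtain ⟨y, hyU, hy0⟩ := U.ne_bot_iff.1 hUb
    have hxy : LinearIndependent F ![x, y] := by
      refine linearIndependent_pair_of_notMem (Submodule.mem_span_singleton_self x) hx
        fun hy => hy0 ?_
      exact Submodule.disjoint_def.1 hU.disjoint y hy hyU
    obtain ⟨b, rfl, rfl⟩ := exists_basis_of_pair hV hxy
    refine hG b fun g hg => mem_setStabilizer_span_singleton.2 ⟨hg.1, ?_⟩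
    obtain ⟨α, β, h⟩ := exists_coeff_of_pair hV hxy (g • b 1)
    refine ⟨β, ?_⟩
    have h1 : α • b 0 ∈ U := by
      have : α • b 0 = g • b 1 - β • b 1 := by rw [h, add_sub_cancel_right]
      rw [this]
      exact U.sub_mem (hUD g hg _ hyU) (U.smul_mem _ hyU)
    have h2 : α • b 0 = 0 := Submodule.disjoint_def.1 hU.disjoint _
      (Submodule.smul_mem _ _ (Submodule.mem_span_singleton_self _)) h1
    rw [h, h2, zero_add]

theorem smul_pair_of_pow_char (hV : Module.finrank F V = 2) (p : ℕ)
    [Fact p.Prime] [CharP F p] {t : GeneralLinearGroup F V} (ht1 : t ≠ 1) (htp : t ^ p = 1)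
    {x y : V} (hxy : LinearIndependent F ![x, y]) (hx : t • x = x) :
    ∃ c : F, c ≠ 0 ∧ t • y = y + c • x := by
  obtain ⟨c, d, h⟩ := exists_coeff_of_pair hV hxy (t • y)
  have hx0 : x ≠ 0 := hxy.ne_zero 0
  have hd : d = 1 := by
    refine eigenvalue_eq_one_of_pow_char p htp (F ∙ x) (fun w hw => ?_) (u := y) (fun hy => ?_) ?_
    · obtain ⟨a, rfl⟩ := Submodule.mem_span_singleton.1 hw
      rwa [smul_comm, hx]
    · obtain ⟨a, ha⟩ := Submodule.mem_span_singleton.1 hy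
      exact (LinearIndependent.pair_iff' hx0).1 hxy a ha
    · rw [h, add_sub_cancel_right]
      exact Submodule.smul_mem _ _ (Submodule.mem_span_singleton_self _)
  refine ⟨c, ?_, by rw [h, hd, one_smul, add_comm]⟩
  rintro rfl
  refine ht1 (generalLinearGroup_ext fun v => ?_)
  obtain ⟨a, b, rfl⟩ := exists_coeff_of_pair hV hxy v
  rw [one_smul, smul_add, smul_comm t, smul_comm t, hx, h, hd]
  simp

theorem irreducible_of_forall_fixing_vector (hV : Module.finrank F V = 2) (p : ℕ)
    [Fact p.Prime] [CharP F p] {G : Subgroup (GeneralLinearGroup F V)}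
    (hG : ∀ x : V, x ≠ 0 → ∃ t ∈ G, t ≠ 1 ∧ t ^ p = 1 ∧ t • x = x) (U : Submodule F V)
    (hU : ∀ g ∈ G, ∀ u ∈ U, g • u ∈ U) : U = ⊥ ∨ U = ⊤ := by
  by_contra! H
  obtain ⟨u, hu, hu0⟩ := U.ne_bot_iff.1 H.1
  obtain ⟨x, hx⟩ : ∃ x, x ∉ U := by
    by_contra! h
    exact H.2 (eq_top_iff.2 fun x _ => h x)
  have hx0 : x ≠ 0 := fun h => hx (h ▸ U.zero_mem)
  have hxu : LinearIndependent F ![x, u] :=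
    LinearIndependent.pair_symm_iff.1 (linearIndependent_pair_of_notMem hu hu0 hx)
  obtain ⟨t, ht, ht1, htp, htx⟩ := hG x hx0
  obtain ⟨c, hc, htu⟩ := smul_pair_of_pow_char hV p ht1 htp hxu htx
  have h1 : c • x ∈ U := by
    have := U.sub_mem (hU t ht u hu) hu
    rwa [htu, add_sub_cancel_left] at this
  exact hx ((U.smul_mem_iff hc).1 h1)

/-! ### Dimension two: the coset of a normal `p'`-subgroup -/

/-- Let `t` have order `p` and normalize a group `N` of order prime to `p`, and let `n ∈ N`.
Then `g = t n` commutes with `g ^ |N|`, which has order `p`, so `g` is a scalar times a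
unipotent element and its characteristic polynomial is a square. -/
theorem exists_smul_smul_eq_of_coset [Finite V] (hV : Module.finrank F V = 2) (p : ℕ)
    [Fact p.Prime] [CharP F p] {N : Subgroup (GeneralLinearGroup F V)}
    (hN : ¬ p ∣ Nat.card N) {t : GeneralLinearGroup F V} (ht1 : t ≠ 1) (htp : t ^ p = 1)
    (htN : ∀ n ∈ N, t * n * t⁻¹ ∈ N) {n : GeneralLinearGroup F V} (hn : n ∈ N) :
    ∃ a : F, ∀ v : V, (t * n) • (t * n) • v = (2 * a) • (t * n) • v - a ^ 2 • v := by
  have hp : p.Prime := Fact.out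
  have : Nontrivial V := Module.nontrivial_of_finrank_pos (R := F) (by omega)
  set g := t * n with hg
  have key : ∀ k : ℕ, g ^ k * (t ^ k)⁻¹ ∈ N := by
    intro k
    induction k with
    | zero => simp
    | succ k ih =>
      have := htN _ (N.mul_mem hn ih)
      convert this using 1
      rw [pow_succ', pow_succ', hg]
      group
  have hNpow : ∀ m ∈ N, m ^ Nat.card N = 1 := fun m hm => by
    have := pow_card_eq_one' (x := (⟨m, hm⟩ : N))
    exact congrArg Subtype.val this
  have hhp : (g ^ Nat.card N) ^ p = 1 := by
    have h1 := key p
    rw [htp, inv_one, mul_one] at h1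
    rw [← pow_mul, mul_comm, pow_mul, hNpow _ h1]
  have hh1 : g ^ Nat.card N ≠ 1 := by
    intro h
    have h1 := key (Nat.card N)
    rw [h, one_mul] at h1
    have h2 := hNpow _ (N.inv_mem h1)
    rw [inv_inv, ← pow_mul] at h2
    have h3 : t ^ (Nat.gcd p (Nat.card N * Nat.card N)) = 1 := pow_gcd_eq_one.2 ⟨htp, h2⟩
    have hc : Nat.Coprime p (Nat.card N) := (Nat.Prime.coprime_iff_not_dvd hp).2 hN
    rw [(Nat.Coprime.mul_right hc hc).gcd_eq_one, pow_one] at h3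
    exact ht1 h3
  have hcomm : Commute g (g ^ Nat.card N) := Commute.self_pow g _
  set h := g ^ Nat.card N
  have hQ : IsPGroup p (Subgroup.zpowers h) := by
    rintro ⟨q, k, rfl⟩
    refine ⟨1, Subtype.ext ?_⟩
    change (h ^ k) ^ p ^ 1 = 1
    rw [pow_one, ← zpow_natCast, ← zpow_mul, mul_comm, zpow_mul, zpow_natCast, hhp, one_zpow]
  obtain ⟨c, hc0, hc⟩ := exists_fixed_vector_of_isPGroup (V := V) p hQ
  have hhc : h • c = c := hc h (Subgroup.mem_zpowers h)
  obtain ⟨y, hcy⟩ := exists_linearIndependent_pair hV hc0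
  obtain ⟨γ, hγ, hhy⟩ := smul_pair_of_pow_char hV p hh1 hhp hcy hhc
  obtain ⟨a, δ, hgc⟩ := exists_coeff_of_pair hV hcy (g • c)
  obtain ⟨ζ, ε, hgy⟩ := exists_coeff_of_pair hV hcy (g • y)
  have e1 : h • g • c = g • c := by rw [← mul_smul, ← hcomm.eq, mul_smul, hhc]
  have hδ : δ = 0 := by
    rw [hgc, smul_add, smul_comm h, smul_comm h, hhc, hhy] at e1
    have := (coeff_eq_of_pair hcy (a := a + δ * γ) (b := δ) (c := a) (d := δ) (by
      rw [← e1]; module)).1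
    simpa [hγ] using this
  subst hδ
  rw [zero_smul, add_zero] at hgc
  have e2 : h • g • y = g • h • y := by rw [← mul_smul, ← mul_smul, hcomm.eq]
  have hε : ε = a := by
    rw [hhy, smul_add g, smul_comm g, hgc, hgy, smul_add, smul_comm h, smul_comm h, hhc, hhy] at e2
    have := (coeff_eq_of_pair hcy (a := ζ + ε * γ) (b := ε) (c := ζ + γ * a) (d := ε) (by
      linear_combination (norm := module) e2)).1
    have h3 : (ε - a) * γ = 0 := by linear_combination this
    exact sub_eq_zero.1 ((mul_eq_zero.1 h3).resolve_right hγ)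
  subst hε
  refine ⟨ε, fun v => ?_⟩
  obtain ⟨α, β, rfl⟩ := exists_coeff_of_pair hV hcy v
  simp only [smul_add, smul_comm g, hgc, hgy]
  module

/-- Trace and determinant form of the previous statement: with `y = n x` and
`n y = τ y - d x`, the element `t n` has trace `τ + c` and determinant `d`. -/
theorem exists_trace_det_eq_of_coset [Finite V] (hV : Module.finrank F V = 2) (p : ℕ)
    [Fact p.Prime] [CharP F p] {N : Subgroup (GeneralLinearGroup F V)}
    (hN : ¬ p ∣ Nat.card N) {t : GeneralLinearGroup F V} (htp : t ^ p = 1)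
    (htN : ∀ n ∈ N, t * n * t⁻¹ ∈ N) {n : GeneralLinearGroup F V} (hn : n ∈ N)
    {x : V} (hx : LinearIndependent F ![x, n • x]) {c d τ : F} (hc : c ≠ 0) (htx : t • x = x)
    (hty : t • n • x = n • x + c • x) (hny : n • n • x = τ • n • x - d • x) :
    ∃ a : F, τ + c = 2 * a ∧ d = a ^ 2 := by
  have ht1 : t ≠ 1 := by
    rintro rfl
    rw [one_smul, left_eq_add, smul_eq_zero] at hty
    exact hty.elim hc (hx.ne_zero 0)
  obtain ⟨a, ha⟩ := exists_smul_smul_eq_of_coset hV p hN ht1 htp htN hn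
  have h := ha x
  simp only [mul_smul, hty, smul_add, smul_comm n, smul_comm t, hny, smul_sub, htx] at h
  generalize n • x = y at h hx
  obtain ⟨h1, h2⟩ := coeff_eq_of_pair hx (a := (τ + c) * c - d) (b := τ + c)
    (c := 2 * a * c - a ^ 2) (d := 2 * a) (by linear_combination (norm := module) h)
  refine ⟨a, h2, ?_⟩
  rw [h2] at h1
  linear_combination -h1

theorem exists_trace_det_eq_of_pow [Finite V] (hV : Module.finrank F V = 2) (p : ℕ)
    [Fact p.Prime] [CharP F p] {N : Subgroup (GeneralLinearGroup F V)}
    (hN : ¬ p ∣ Nat.card N) {t : GeneralLinearGroup F V} (htp : t ^ p = 1)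
    (htN : ∀ n ∈ N, t * n * t⁻¹ ∈ N) {n : GeneralLinearGroup F V} (hn : n ∈ N)
    {x : V} (hx : LinearIndependent F ![x, n • x]) {c d τ : F} (hc : c ≠ 0) (htx : t • x = x)
    (hty : t • n • x = n • x + c • x) (hny : n • n • x = τ • n • x - d • x)
    {k : ℕ} (hk : (k : F) ≠ 0) : ∃ a : F, τ + k * c = 2 * a ∧ d = a ^ 2 := by
  have h1 : ∀ k : ℕ, t ^ k • x = x ∧ t ^ k • n • x = n • x + (k * c) • x ∧
      ∀ n ∈ N, t ^ k * n * (t ^ k)⁻¹ ∈ N := by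
    intro k
    induction k with
    | zero => simp
    | succ k ih =>
      obtain ⟨h1, h2, h3⟩ := ih
      refine ⟨by rw [pow_succ', mul_smul, h1, htx], ?_, fun n hn => ?_⟩
      · rw [pow_succ', mul_smul, h2, smul_add, hty, smul_comm t (k * c : F), htx, Nat.cast_succ, add_mul,
          one_mul, add_smul, add_assoc, add_comm (c • x)]
      · have := htN _ (h3 n hn)
        convert this using 1
        rw [pow_succ']
        group
  obtain ⟨h2, h3, h4⟩ := h1 k
  exact exists_trace_det_eq_of_coset hV p hN (by rw [← pow_mul, mul_comm, pow_mul, htp, one_pow])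
    h4 hn hx (mul_ne_zero hk hc) h2 h3 hny

/-- A vector that is not an eigenvector of an element of `N` is fixed by an element of order
`p` of `G`; the matrix entries `c, d, τ` describe both elements in the basis `x, n x`. -/
theorem exists_matrix_entries [Finite V] (hV : Module.finrank F V = 2) (p : ℕ)
    [Fact p.Prime] [CharP F p] {G : Subgroup (GeneralLinearGroup F V)}
    (hG : ∀ x : V, x ≠ 0 → ∃ t ∈ G, t ≠ 1 ∧ t ^ p = 1 ∧ t • x = x)
    {n : GeneralLinearGroup F V} {x : V} (hx : LinearIndependent F ![x, n • x]) :
    ∃ t ∈ G, ∃ c d τ : F, t ^ p = 1 ∧ c ≠ 0 ∧ t • x = x ∧ t • n • x = n • x + c • x ∧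
      n • n • x = τ • n • x - d • x := by
  obtain ⟨t, ht, ht1, htp, htx⟩ := hG x (hx.ne_zero 0)
  obtain ⟨c, hc, hty⟩ := smul_pair_of_pow_char hV p ht1 htp hx htx
  obtain ⟨d, τ, h⟩ := exists_coeff_of_pair hV hx (n • n • x)
  exact ⟨t, ht, c, -d, τ, htp, hc, htx, hty, by rw [h, neg_smul, sub_neg_eq_add, add_comm]⟩

/-- For `p ≥ 5` three nontrivial powers of `t` give three solutions of a quadratic equation. -/
theorem char_le_three_of_linearIndependent [Finite V] (hV : Module.finrank F V = 2) (p : ℕ)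
    [Fact p.Prime] [CharP F p] {G N : Subgroup (GeneralLinearGroup F V)}
    (hG : ∀ x : V, x ≠ 0 → ∃ t ∈ G, t ≠ 1 ∧ t ^ p = 1 ∧ t • x = x)
    (hN : ¬ p ∣ Nat.card N) (hGN : ∀ g ∈ G, ∀ n ∈ N, g * n * g⁻¹ ∈ N)
    {n : GeneralLinearGroup F V} (hn : n ∈ N) {x : V}
    (hx : LinearIndependent F ![x, n • x]) : p = 2 ∨ p = 3 := by
  have hp : p.Prime := Fact.out
  by_contra! H
  obtain ⟨t, ht, c, d, τ, htp, hc, htx, hty, hny⟩ := exists_matrix_entries hV p hG hx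
  have key := fun k hk =>
    exists_trace_det_eq_of_pow hV p hN htp (hGN t ht) hn hx hc htx hty hny (k := k) hk
  have h2 : (2 : F) ≠ 0 := by
    intro h
    have : ((2 : ℕ) : F) = 0 := by exact_mod_cast h
    rw [CharP.cast_eq_zero_iff F p, Nat.prime_dvd_prime_iff_eq hp Nat.prime_two] at this
    exact H.1 this
  have h3 : (3 : F) ≠ 0 := by
    intro h
    have : ((3 : ℕ) : F) = 0 := by exact_mod_cast h
    rw [CharP.cast_eq_zero_iff F p, Nat.prime_dvd_prime_iff_eq hp Nat.prime_three] at this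
    exact H.2 this
  obtain ⟨a, ha, hd⟩ := key 1 (by simp)
  obtain ⟨b, hb, hd'⟩ := key 2 (by exact_mod_cast h2)
  obtain ⟨e, he, hd''⟩ := key 3 (by exact_mod_cast h3)
  push_cast at ha hb he
  have e1 : c * (2 * τ + 3 * c) = 0 := by
    linear_combination (τ + 2 * c + 2 * b) * hb - (τ + 1 * c + 2 * a) * ha + 4 * hd - 4 * hd'
  have e2 : (2 * c) * (2 * τ + 4 * c) = 0 := by
    linear_combination (τ + 3 * c + 2 * e) * he - (τ + 1 * c + 2 * a) * ha + 4 * hd - 4 * hd''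
  have e3 := (mul_eq_zero.1 e1).resolve_left hc
  have e4 := (mul_eq_zero.1 e2).resolve_left (mul_ne_zero h2 hc)
  exact hc (by linear_combination e4 - e3)

/-! ### Dimension two: characteristic three -/

/-- In characteristic `3` noncentral elements of `N` have trace `0`. -/
theorem smul_smul_eq_of_char_three [Finite V] (hV : Module.finrank F V = 2)
    [CharP F 3] {G N : Subgroup (GeneralLinearGroup F V)}
    (hG : ∀ x : V, x ≠ 0 → ∃ t ∈ G, t ≠ 1 ∧ t ^ 3 = 1 ∧ t • x = x)
    (hN : ¬ 3 ∣ Nat.card N) (hGN : ∀ g ∈ G, ∀ n ∈ N, g * n * g⁻¹ ∈ N)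
    {n : GeneralLinearGroup F V} (hn : n ∈ N) {x : V}
    (hx : LinearIndependent F ![x, n • x]) :
    ∃ t ∈ G, ∃ c : F, t ^ 3 = 1 ∧ c ≠ 0 ∧ t • x = x ∧ t • n • x = n • x + c • x ∧
      n • n • x = -(c ^ 2 • x) := by
  have h3 : (3 : F) = 0 := by exact_mod_cast CharP.cast_eq_zero F 3
  have h2 : (2 : F) ≠ 0 := fun h => one_ne_zero (α := F) (by linear_combination h3 - h)
  have : Fact (Nat.Prime 3) := ⟨Nat.prime_three⟩
  obtain ⟨t, ht, c, d, τ, htp, hc, htx, hty, hny⟩ := exists_matrix_entries hV 3 hG hx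
  have key := fun k hk =>
    exists_trace_det_eq_of_pow hV 3 hN htp (hGN t ht) hn hx hc htx hty hny (k := k) hk
  obtain ⟨a, ha, hd⟩ := key 1 (by simp)
  obtain ⟨b, hb, hd'⟩ := key 2 (by exact_mod_cast h2)
  push_cast at ha hb
  have e1 : (2 * c) * τ = 0 := by
    linear_combination (τ + 2 * c + 2 * b) * hb - (τ + 1 * c + 2 * a) * ha + 4 * hd - 4 * hd' -
      c ^ 2 * h3
  have e2 : τ = 0 := (mul_eq_zero.1 e1).resolve_left (mul_ne_zero h2 hc)
  subst e2
  have e3 : d = c ^ 2 := by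
    linear_combination hd - (c + 2 * a) * ha - a ^ 2 * h3
  exact ⟨t, ht, c, htp, hc, htx, hty, by rw [hny, e3, zero_smul, zero_sub]⟩

theorem exists_unipotent_of_smul_smul_eq_neg [Finite V] (hV : Module.finrank F V = 2)
    [CharP F 3] {G N : Subgroup (GeneralLinearGroup F V)}
    (hG : ∀ x : V, x ≠ 0 → ∃ t ∈ G, t ≠ 1 ∧ t ^ 3 = 1 ∧ t • x = x)
    (hN : ¬ 3 ∣ Nat.card N) (hGN : ∀ g ∈ G, ∀ n ∈ N, g * n * g⁻¹ ∈ N)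
    {n : GeneralLinearGroup F V} (hn : n ∈ N) {x : V}
    (hx : LinearIndependent F ![x, n • x]) (hnx : n • n • x = -x) :
    ∃ m ∈ N, m • x = x + n • x ∧ m • n • x = x - n • x := by
  have h3 : (3 : F) = 0 := by exact_mod_cast CharP.cast_eq_zero F 3
  obtain ⟨t, ht, c, htp, hc, htx, hty, hny⟩ := smul_smul_eq_of_char_three hV hG hN hGN hn hx
  have h1 : (c ^ 2 - 1) • x = 0 := by
    rw [hnx, neg_inj] at hny
    rw [sub_smul, ← hny, one_smul, sub_self]
  have h2 : (c - 1) * (c + 1) = 0 := by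
    have := (smul_eq_zero.1 h1).resolve_right (hx.ne_zero 0)
    linear_combination this
  obtain ⟨s, hs, hsx, hsy⟩ : ∃ s ∈ G, s • x = x ∧ s • n • x = n • x + x := by
    rcases mul_eq_zero.1 h2 with h | h
    · exact ⟨t, ht, htx, by rw [hty, sub_eq_zero.1 h, one_smul]⟩
    · refine ⟨t⁻¹, G.inv_mem ht, by rw [inv_smul_eq_iff, htx], ?_⟩
      rw [inv_smul_eq_iff, smul_add, htx, hty, eq_neg_of_add_eq_zero_left h]
      simp
  refine ⟨s * n * s⁻¹, hGN s hs n hn, ?_, ?_⟩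
  · rw [mul_smul, mul_smul, inv_smul_eq_iff.2 hsx.symm, hsy, add_comm]
  · have h4 : s⁻¹ • n • x = n • x - x := by
      rw [inv_smul_eq_iff, smul_sub, hsx, hsy, add_sub_cancel_right]
    rw [mul_smul, mul_smul, h4, smul_sub, smul_sub, hnx, hsy, smul_neg, hsx]
    generalize n • x = y
    linear_combination (norm := module) (-h3) • x

/-- Take `x` and `y = n x` with `n y = -x` as `1` and `i`, so that `n` is multiplication by `i`.
The conjugates of `n` attached to `x` and to `w = c x + y` are `z ↦ (1 + i) z̄` and
`z ↦ (w / w̄) (1 + i) z̄`, whose product is multiplication by `w / w̄` up to a scalar. This is neither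
scalar nor of trace `0` unless `c⁵ = c`; a suitable `c` exists as `|F| ≥ 9`. -/
theorem false_of_char_three [Finite F] [Finite V] (hV : Module.finrank F V = 2)
    [CharP F 3] (hF : 5 ≤ Nat.card F) {G N : Subgroup (GeneralLinearGroup F V)}
    (hG : ∀ x : V, x ≠ 0 → ∃ t ∈ G, t ≠ 1 ∧ t ^ 3 = 1 ∧ t • x = x)
    (hN : ¬ 3 ∣ Nat.card N) (hGN : ∀ g ∈ G, ∀ n ∈ N, g * n * g⁻¹ ∈ N)
    (hZN : scalarGroup F V ≤ N)
    {n : GeneralLinearGroup F V} (hn : n ∈ N) {x : V}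
    (hx : LinearIndependent F ![x, n • x]) : False := by
  have h3 : (3 : F) = 0 := by exact_mod_cast CharP.cast_eq_zero F 3
  have h2 : (2 : F) ≠ 0 := fun h => one_ne_zero (α := F) (by linear_combination h3 - h)
  have : Nontrivial V := Module.nontrivial_of_finrank_pos (R := F) (by omega)
  have hx0 : x ≠ 0 := hx.ne_zero 0
  -- rescale `n` so that its square is `-1`
  obtain ⟨n, hn, hx, hnx⟩ : ∃ n ∈ N, LinearIndependent F ![x, n • x] ∧ n • n • x = -x := by
    obtain ⟨-, -, c, -, hc, -, -, hny⟩ := smul_smul_eq_of_char_three hV hG hN hGN hn hx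
    have hz : ∀ v : V, (Units.map (algebraMap F (Module.End F V)).toMonoidHom
      (Units.mk0 c hc)⁻¹ : GeneralLinearGroup F V) • v = c⁻¹ • v := fun v => rfl
    refine ⟨_, N.mul_mem (hZN ⟨(Units.mk0 c hc)⁻¹, rfl⟩) hn, ?_, ?_⟩
    · rw [mul_smul, hz, LinearIndependent.pair_iff' hx0]
      intro a ha
      refine (LinearIndependent.pair_iff' hx0).1 hx (c * a) ?_
      rw [mul_smul, ha, smul_inv_smul₀ hc]
    · rw [mul_smul, mul_smul, hz, hz, smul_comm n, hny, smul_smul, smul_neg, smul_smul]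
      congr 1
      rw [← mul_inv, ← sq, inv_mul_cancel₀ (pow_ne_zero 2 hc), one_smul]
  obtain ⟨c, hc⟩ : ∃ c : F, c ^ 5 - c ≠ 0 := by
    have := Fintype.ofFinite F
    have h9 : 5 < Nat.card F := by
      rcases hF.lt_or_eq with h | h
      · exact h
      · have h5 : ((5 : ℕ) : F) = 0 := by
          rw [h, Nat.card_eq_fintype_card, FiniteField.cast_card_eq_zero]
        exfalso
        rw [CharP.cast_eq_zero_iff F 3] at h5
        omega
    by_contra! H
    have hdeg : (Polynomial.X ^ 5 - Polynomial.X : Polynomial F).natDegree = 5 := by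
      compute_degree!
    have h0 : (Polynomial.X ^ 5 - Polynomial.X : Polynomial F) ≠ 0 := by
      intro h
      rw [h, Polynomial.natDegree_zero] at hdeg
      omega
    have h1 := Polynomial.card_le_degree_of_subset_roots
      (p := (Polynomial.X ^ 5 - Polynomial.X : Polynomial F)) (Z := Finset.univ) (by
        intro c _
        rw [Polynomial.mem_roots h0, Polynomial.IsRoot.def]
        simpa using H c)
    rw [hdeg, Finset.card_univ, ← Nat.card_eq_fintype_card] at h1
    omega
  have hc0 : c ≠ 0 := fun h => hc (by rw [h]; ring)
  have hc1 : c ^ 2 - 1 ≠ 0 := fun h => hc (by linear_combination (c ^ 3 + c) * h)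
  have hD : c ^ 2 + 1 ≠ 0 := fun h => hc (by linear_combination (c ^ 3 - c) * h)
  obtain ⟨m, hm, hmx, hmy⟩ := exists_unipotent_of_smul_smul_eq_neg hV hG hN hGN hn hx hnx
  have hny' : n • (c • x + n • x) = c • n • x - x := by
    rw [smul_add, smul_comm n, hnx, sub_eq_add_neg]
  have hx' : LinearIndependent F ![c • x + n • x, n • (c • x + n • x)] := by
    rw [hny', LinearIndependent.pair_iff]
    intro a b hab
    generalize n • x = y at *
    obtain ⟨e1, e2⟩ := coeff_eq_of_pair hx (a := a * c - b) (b := a + b * c) (c := 0) (d := 0) (by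
      linear_combination (norm := module) hab)
    have ha : a * (c ^ 2 + 1) = 0 := by linear_combination c * e1 + e2
    have hb : b * (c ^ 2 + 1) = 0 := by linear_combination c * e2 - e1
    exact ⟨(mul_eq_zero.1 ha).resolve_right hD, (mul_eq_zero.1 hb).resolve_right hD⟩
  have hnx' : n • n • (c • x + n • x) = -(c • x + n • x) := by
    rw [hny', smul_sub, smul_comm n, hnx]
    generalize n • x = y
    module
  obtain ⟨m', hm', hmx', hmy'⟩ := exists_unipotent_of_smul_smul_eq_neg hV hG hN hGN hn hx' hnx'
  rw [hny'] at hmx' hmy'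
  have hkN : m' * m ∈ N := N.mul_mem hm' hm
  -- `A + B n` is `w / w̄` up to a scalar
  obtain ⟨i, hi⟩ : ∃ i : F, (c ^ 2 + 1) * i = 1 := ⟨_, mul_inv_cancel₀ hD⟩
  obtain ⟨A, hA⟩ : ∃ A, A = 2 * (c ^ 2 - 1) * i := ⟨_, rfl⟩
  obtain ⟨B, hB⟩ : ∃ B, B = 4 * c * i := ⟨_, rfl⟩
  have hi0 : i ≠ 0 := right_ne_zero_of_mul_eq_one hi
  have hA0 : A ≠ 0 := hA ▸ mul_ne_zero (mul_ne_zero h2 hc1) hi0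
  have hB0 : B ≠ 0 := hB ▸ mul_ne_zero (mul_ne_zero
    (fun h => h2 (by linear_combination 2 * h - 2 * h3)) hc0) hi0
  have hkx : (m' * m) • x = A • x + B • n • x ∧ (m' * m) • n • x = -B • x + A • n • x := by
    rw [mul_smul, mul_smul, hmx, hmy]
    generalize n • x = y at *
    have e1 : x + y = i • ((c + 1) • (c • x + y) + (c - 1) • (c • y - x)) := by
      linear_combination (norm := module) (-hi) • (x + y)
    have e2 : x - y = i • ((c - 1) • (c • x + y) + (-1 - c) • (c • y - x)) := by
      linear_combination (norm := module) (-hi) • (x - y)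
    constructor
    · rw [e1, smul_comm m' i, smul_add, smul_comm m', smul_comm m', hmx', hmy', hA, hB]
      module
    · rw [e2, smul_comm m' i, smul_add, smul_comm m', smul_comm m', hmx', hmy', hA, hB]
      module
  have hind : LinearIndependent F ![x, (m' * m) • x] := by
    rw [hkx.1, LinearIndependent.pair_iff' hx0]
    intro a ha
    generalize n • x = y at *
    have := (coeff_eq_of_pair hx (a := a) (b := 0) (c := A) (d := B) (by
      rw [← ha]; module)).2
    exact hB0 this.symm
  obtain ⟨-, -, a, -, -, -, -, ha⟩ := smul_smul_eq_of_char_three hV hG hN hGN hkN hind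
  rw [hkx.1, smul_add, smul_comm _ A, smul_comm _ B, hkx.1, hkx.2] at ha
  generalize n • x = y at *
  have := (coeff_eq_of_pair hx (a := A ^ 2 - B ^ 2) (b := 2 * A * B) (c := -a ^ 2) (d := 0) (by
    linear_combination (norm := module) ha)).2
  exact mul_ne_zero (mul_ne_zero h2 hA0) hB0 this

/-! ### Dimension two: characteristic two and conclusion -/

/-- In characteristic `2` the trace condition determines the transvections of `G` with center
`x`: there is only one, so the stabilizer of its line is generated by it and the scalars. -/
theorem exists_basis_of_char_two [Finite V] (hV : Module.finrank F V = 2)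
    [CharP F 2] {G N : Subgroup (GeneralLinearGroup F V)}
    (hG : ∀ x : V, x ≠ 0 → ∃ t ∈ G, t ≠ 1 ∧ t ^ 2 = 1 ∧ t • x = x)
    (hN : ¬ 2 ∣ Nat.card N) (hGN : ∀ g ∈ G, ∀ n ∈ N, g * n * g⁻¹ ∈ N)
    (hZG : scalarGroup F V ≤ G)
    {n : GeneralLinearGroup F V} (hn : n ∈ N) {x : V}
    (hx : LinearIndependent F ![x, n • x]) :
    ∃ b : Module.Basis (Fin 2) F V,
        (∃ C : Subgroup (LinearMap.GeneralLinearGroup F V), Nat.card C = 2 ∧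
          IsInternalDirectProduct (setStabilizer G (Submodule.span F {b 0} : Set V))
            (scalarGroup F V) C) ∧
        ∀ g ∈ setStabilizer G (Submodule.span F {b 0} : Set V), orderOf g = 2 →
          (g : Module.End F V) (b 0) = b 0 ∧ (g : Module.End F V) (b 1) = b 1 + b 0 := by
  have h2 : (2 : F) = 0 := by exact_mod_cast CharP.cast_eq_zero F 2
  have : Fact (Nat.Prime 2) := ⟨Nat.prime_two⟩
  obtain ⟨t, ht, c, d, τ, htp, hc, htx, hty, hny⟩ := exists_matrix_entries hV 2 hG hx
  -- `c` is the trace of `n` and does not depend on `t`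
  have huniq : ∀ s ∈ G, ∀ e : F, s ^ 2 = 1 → e ≠ 0 → s • x = x →
      s • n • x = n • x + e • x → e = -τ := by
    intro s hs e hsp he hsx hsy
    obtain ⟨a, ha, -⟩ := exists_trace_det_eq_of_coset hV 2 hN hsp (hGN s hs) hn hx he hsx hsy hny
    linear_combination ha + a * h2
  have hcτ := huniq t ht c htp hc htx hty
  have hx0 : x ≠ 0 := hx.ne_zero 0
  have hb : LinearIndependent F ![x, c⁻¹ • n • x] := by
    rw [LinearIndependent.pair_iff' hx0]
    intro a ha
    refine (LinearIndependent.pair_iff' hx0).1 hx (c * a) ?_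
    rw [mul_smul, ha, smul_inv_smul₀ hc]
  generalize n • x = y at *
  have ht1 : t ≠ 1 := by
    rintro rfl
    rw [one_smul, left_eq_add, smul_eq_zero] at hty
    exact hty.elim hc hx0
  have htx2 : ∀ s : GeneralLinearGroup F V, s • x = x → ∀ e : F, s • y = y + e • x →
      s ^ 2 = 1 := by
    intro s hsx e hsy
    refine generalLinearGroup_ext fun v => ?_
    obtain ⟨α, β, rfl⟩ := exists_coeff_of_pair hV hx v
    simp only [sq, mul_smul, smul_add, smul_comm s, hsx, hsy, one_smul]
    linear_combination (norm := module) (h2 * β * e) • x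
  have hclass : ∀ s ∈ G, s • x = x → ∀ e : F, s • y = y + e • x → s = 1 ∨ s = t := by
    intro s hs hsx e hsy
    by_cases he : e = 0
    · left
      refine generalLinearGroup_ext fun v => ?_
      obtain ⟨α, β, rfl⟩ := exists_coeff_of_pair hV hx v
      rw [smul_add, smul_comm s, smul_comm s, hsx, hsy, he, zero_smul, add_zero, one_smul]
    · right
      have h1 : e = c := (huniq s hs e (htx2 s hsx e hsy) he hsx hsy).trans hcτ.symm
      refine generalLinearGroup_ext fun v => ?_
      obtain ⟨α, β, rfl⟩ := exists_coeff_of_pair hV hx v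
      rw [smul_add, smul_add, smul_comm s, smul_comm s, smul_comm t, smul_comm t, hsx, hsy, htx,
        hty, h1]
  have hstab : ∀ g ∈ setStabilizer G (Submodule.span F {x} : Set V),
      ∃ z ∈ scalarGroup F V, z⁻¹ * g = 1 ∨ z⁻¹ * g = t := by
    intro g hg
    obtain ⟨hgG, α, hgx⟩ := mem_setStabilizer_span_singleton.1 hg
    have hα : α ≠ 0 := by
      rintro rfl
      rw [zero_smul, smul_eq_zero_iff_eq] at hgx
      exact hx0 hgx
    obtain ⟨γ, β, hgy⟩ := exists_coeff_of_pair hV hx (g • y)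
    have hβ : β ≠ 0 := by
      rintro rfl
      have : g • (α • y - γ • x) = 0 := by
        rw [smul_sub, smul_comm g, smul_comm g, hgx, hgy]
        module
      rw [smul_eq_zero_iff_eq] at this
      exact hα (coeff_eq_of_pair hx (a := -γ) (b := α) (c := 0) (d := 0) (by
        linear_combination (norm := module) this)).2
    have hβα : β = α := by
      -- conjugating `t` by `g` multiplies `c` by `α / β`
      have h1 : (g * t * g⁻¹) • x = x := by
        have : g⁻¹ • x = α⁻¹ • x := by
          rw [inv_smul_eq_iff, smul_comm g, hgx, inv_smul_smul₀ hα]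
        rw [mul_smul, mul_smul, this, smul_comm t, htx, smul_comm g, hgx, inv_smul_smul₀ hα]
      have h2 : (g * t * g⁻¹) • y = y + (β⁻¹ * c * α) • x := by
        have : g⁻¹ • y = β⁻¹ • (y - (γ * α⁻¹) • x) := by
          rw [inv_smul_eq_iff, smul_comm g, smul_sub, smul_comm g, hgx, hgy, smul_smul,
            inv_mul_cancel_right₀ hα, add_sub_cancel_left, inv_smul_smul₀ hβ]
        have h3 : t • (y - (γ * α⁻¹) • x) = (y - (γ * α⁻¹) • x) + c • x := by
          rw [smul_sub, smul_comm t, htx, hty]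
          abel
        rw [mul_smul, mul_smul, this, smul_comm t, h3, smul_add, ← this, smul_add,
          smul_inv_smul, smul_comm g, smul_comm g, hgx, smul_smul, smul_smul]
      have h4 := huniq _ (G.mul_mem (G.mul_mem hgG ht) (G.inv_mem hgG)) _
        (htx2 _ h1 _ h2) (mul_ne_zero (mul_ne_zero (inv_ne_zero hβ) hc) hα) h1 h2
      rw [← hcτ] at h4
      have h5 : (α - β) * c = 0 := by
        have h6 : β * β⁻¹ = 1 := mul_inv_cancel₀ hβ
        linear_combination β * h4 - c * α * h6
      exact (sub_eq_zero.1 ((mul_eq_zero.1 h5).resolve_right hc)).symm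
    subst hβα
    obtain ⟨z, hz, hzv⟩ : ∃ z ∈ scalarGroup F V, ∀ v : V, z • v = β • v :=
      ⟨_, ⟨Units.mk0 β hα, rfl⟩, fun v => rfl⟩
    refine ⟨z, hz, hclass _ (G.mul_mem (G.inv_mem (hZG hz)) hgG) ?_ (β⁻¹ * γ) ?_⟩
    · rw [mul_smul, inv_smul_eq_iff, hzv, hgx]
    · rw [mul_smul, inv_smul_eq_iff, hzv, hgy, smul_add, smul_smul, mul_inv_cancel_left₀ hα,
        add_comm]
  have hst : t ∈ setStabilizer G (Submodule.span F {x} : Set V) :=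
    mem_setStabilizer_span_singleton.2 ⟨ht, 1, by rw [htx, one_smul]⟩
  obtain ⟨b, hb0, hb1⟩ := exists_basis_of_pair hV hb
  refine ⟨b, ⟨Subgroup.zpowers t, ?_, ?_, ?_, ?_⟩, ?_⟩
  · rw [Nat.card_zpowers]
    exact orderOf_eq_prime htp ht1
  · intro z hz s _
    exact (scalarGroup_mul_comm hz s).symm
  · rw [eq_bot_iff]
    rintro z ⟨hz, k, hk⟩
    obtain ⟨a, ha⟩ := mem_scalarGroup.1 hz
    have hzx : z • x = x := by
      have : t ^ k ∈ MulAction.stabilizer (GeneralLinearGroup F V) x :=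
        Subgroup.zpow_mem _ (MulAction.mem_stabilizer_iff.2 htx) k
      rw [← hk]
      exact this
    have ha1 : (a : F) = 1 := by
      have h5 : ((a : F) - 1) • x = 0 := by
        rw [sub_smul, one_smul, sub_eq_zero]
        exact (ha x).symm.trans hzx
      exact sub_eq_zero.1 ((smul_eq_zero.1 h5).resolve_right hx0)
    rw [Subgroup.mem_bot]
    refine generalLinearGroup_ext fun v => ?_
    rw [ha v, one_smul]
    change (a : F) • v = v
    rw [ha1, one_smul]
  · rw [hb0]
    refine le_antisymm (sup_le (fun z hz => ?_) ?_) fun g hg => ?_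
    · obtain ⟨a, ha⟩ := mem_scalarGroup.1 hz
      exact mem_setStabilizer_span_singleton.2 ⟨hZG hz, a, ha x⟩
    · rwa [Subgroup.zpowers_le]
    · obtain ⟨z, hz, h⟩ := hstab g hg
      rw [← mul_inv_cancel_left z g]
      refine Subgroup.mul_mem_sup hz ?_
      rcases h with h | h
      · rw [h]; exact Subgroup.one_mem _
      · rw [h]; exact Subgroup.mem_zpowers t
  · rw [hb0, hb1]
    intro g hg hg2
    obtain ⟨z, hz, h⟩ := hstab g hg
    have hgp : g ^ 2 = 1 := hg2 ▸ pow_orderOf_eq_one g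
    obtain ⟨-, α, hgx⟩ := mem_setStabilizer_span_singleton.1 hg
    have hz1 : z = 1 := by
      obtain ⟨a, ha⟩ := mem_scalarGroup.1 hz
      have hzg : z • x = g • x := by
        rcases h with h | h
        · rw [inv_mul_eq_one] at h
          rw [h]
        · rw [inv_mul_eq_iff_eq_mul] at h
          rw [h, mul_smul, htx]
      rw [smul_eq_self_of_pow_char 2 hgp hgx, ha] at hzg
      have h5 : ((a : F) - 1) • x = 0 := by
        rw [sub_smul, one_smul, sub_eq_zero]
        exact hzg
      have ha1 := sub_eq_zero.1 ((smul_eq_zero.1 h5).resolve_right hx0)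
      refine generalLinearGroup_ext fun v => ?_
      rw [ha v, one_smul]
      change (a : F) • v = v
      rw [ha1, one_smul]
    rw [hz1, inv_one, one_mul] at h
    rcases h with h | h
    · rw [h, orderOf_one] at hg2
      omega
    · subst h
      refine ⟨htx, ?_⟩
      rw [coe_apply_eq_smul, smul_comm g, hty, smul_add, inv_smul_smul₀ hc]

theorem exists_basis_of_finrank_two [Finite F] [Finite V] (hV : Module.finrank F V = 2)
    (hF : 5 ≤ Nat.card F) (p : ℕ) [Fact p.Prime] [CharP F p]
    {G : Subgroup (GeneralLinearGroup F V)} (hZG : scalarGroup F V ≤ G) (hG : IsPSolvable p G) :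
    (∃ b : Module.Basis (Fin 2) F V,
        setStabilizer G (Submodule.span F {b 0} : Set V) ≤
          setStabilizer G (Submodule.span F {b 1} : Set V)) ∨
      (p = 2 ∧ ∃ b : Module.Basis (Fin 2) F V,
        (∃ C : Subgroup (LinearMap.GeneralLinearGroup F V), Nat.card C = 2 ∧
          IsInternalDirectProduct (setStabilizer G (Submodule.span F {b 0} : Set V))
            (scalarGroup F V) C) ∧
        ∀ g ∈ setStabilizer G (Submodule.span F {b 0} : Set V), orderOf g = 2 →
          (g : Module.End F V) (b 0) = b 0 ∧ (g : Module.End F V) (b 1) = b 1 + b 0) := by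
  rw [or_iff_not_imp_left]
  intro h
  rw [not_exists] at h
  have : Nontrivial V := Module.nontrivial_of_finrank_pos (R := F) (by omega)
  have htr : ∀ x : V, x ≠ 0 → ∃ t ∈ G, t ≠ 1 ∧ t ^ p = 1 ∧ t • x = x := fun x hx =>
    exists_pow_char_eq_one_fixing_vector hV p h hx
  have hGZ : ¬ G ≤ scalarGroup F V := by
    intro hle
    obtain ⟨x, hx⟩ := exists_ne (0 : V)
    obtain ⟨y, hxy⟩ := exists_linearIndependent_pair hV hx
    obtain ⟨t, ht, ht1, htp, htx⟩ := htr x hx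
    obtain ⟨a, ha⟩ := mem_scalarGroup.1 (hle ht)
    obtain ⟨c, hc, hty⟩ := smul_pair_of_pow_char hV p ht1 htp hxy htx
    have h1 : t • y = (a : F) • y := ha y
    exact hc (coeff_eq_of_pair hxy (a := c) (b := 1) (c := 0) (d := a) (by
      rw [zero_smul, zero_add, ← h1, hty, one_smul, add_comm])).1
  obtain ⟨N, -, hZN, hGN, hNZ, hN⟩ := exists_normal_not_dvd_card p hZG hG hGZ
    (irreducible_of_forall_fixing_vector hV p htr)
  obtain ⟨n, hn, hnZ⟩ := SetLike.not_le_iff_exists.1 hNZ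
  obtain ⟨x, hx⟩ := exists_forall_smul_ne hnZ
  have hx0 : x ≠ 0 := by
    rintro rfl
    exact hx 0 (by simp)
  have hind : LinearIndependent F ![x, n • x] :=
    (LinearIndependent.pair_iff' hx0).2 fun a ha => hx a ha.symm
  rcases char_le_three_of_linearIndependent hV p htr hN hGN hn hind with rfl | rfl
  · exact ⟨rfl, exists_basis_of_char_two hV htr hN hGN hZG hn hind⟩
  · exact (false_of_char_three hV hF htr hN hGN hZN hn hind).elim

/-! ### Commutative subgroups invariant under coprime action -/

open Pointwise in
/-- An automorphism `φ` with `φ ^ p = 1` fixes a Sylow `r`-subgroup of a group of order prime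
to `p`; the center of that Sylow subgroup is the required subgroup. -/
theorem exists_commutative_isPGroup_of_coprime {N : Type*} [Group N] [Finite N] {p r : ℕ}
    [Fact p.Prime] [Fact r.Prime] (hpN : ¬ p ∣ Nat.card N) (hr : r ∣ Nat.card N)
    {φ : MulAut N} (hφ : φ ^ p = 1) :
    ∃ C : Subgroup N, C ≠ ⊥ ∧ IsPGroup r C ∧ (∀ a ∈ C, ∀ b ∈ C, a * b = b * a) ∧
      ∀ a ∈ C, φ a ∈ C := by
  have hQ : IsPGroup p (Subgroup.zpowers φ) := by
    rintro ⟨q, k, rfl⟩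
    refine ⟨1, Subtype.ext ?_⟩
    change (φ ^ k) ^ p ^ 1 = 1
    rw [pow_one, ← zpow_natCast, ← zpow_mul, mul_comm, zpow_mul, zpow_natCast, hφ, one_zpow]
  obtain ⟨P, hP⟩ := hQ.nonempty_fixed_point_of_prime_not_dvd_card (Sylow r N) (fun h => hpN (by
    obtain ⟨P⟩ : Nonempty (Sylow r N) := inferInstance
    exact (h.trans P.card_dvd_index).trans P.index_dvd_card))
  have hφP : φ • P = P := hP ⟨φ, Subgroup.mem_zpowers φ⟩
  have hmem : ∀ a, a ∈ P → φ a ∈ P := fun a ha => by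
    have : φ • a ∈ φ • (P : Subgroup N) := Subgroup.smul_mem_pointwise_smul a φ _ ha
    rw [← Sylow.pointwise_smul_def, hφP] at this
    exact this
  have hmem' : ∀ a, a ∈ P → φ⁻¹ a ∈ P := fun a ha => by
    have h1 : φ⁻¹ • P = P := by rw [inv_smul_eq_iff, hφP]
    have : φ⁻¹ • a ∈ φ⁻¹ • (P : Subgroup N) := Subgroup.smul_mem_pointwise_smul a φ⁻¹ _ ha
    rw [← Sylow.pointwise_smul_def, h1] at this
    exact this
  have hPnt : Nontrivial P := by
    rw [← Finite.one_lt_card_iff_nontrivial, P.card_eq_multiplicity]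
    refine Nat.one_lt_pow ?_ (Fact.out : r.Prime).one_lt
    exact ((Fact.out : r.Prime).factorization_pos_of_dvd Nat.card_pos.ne' hr).ne'
  have hcent := P.isPGroup'.bot_lt_center
  refine ⟨(Subgroup.center P).map (P : Subgroup N).subtype, ?_, ?_, ?_, ?_⟩
  · rw [Ne, Subgroup.map_eq_bot_iff_of_injective _ (Subgroup.subtype_injective _)]
    exact hcent.ne'
  · exact (P.isPGroup'.to_subgroup _).map _
  · rintro _ ⟨a, ha, rfl⟩ _ ⟨b, hb, rfl⟩
    exact congrArg Subtype.val (Subgroup.mem_center_iff.1 hb a)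
  · rintro _ ⟨a, ha, rfl⟩
    refine ⟨⟨φ a, hmem _ a.2⟩, Subgroup.mem_center_iff.2 fun b => Subtype.ext ?_, rfl⟩
    have h1 := congrArg (fun x : P => φ (x : N))
      (Subgroup.mem_center_iff.1 ha ⟨φ⁻¹ b, hmem' _ b.2⟩)
    simpa using h1

/-! ### Dimension three: transvections with every axis -/

/-- Every plane `W` is the axis of a transvection in `G`: an element of order `p` that fixes
exactly the vectors of `W` and acts trivially on `V ⧸ W`. -/
def HasTransvections (p : ℕ) (G : Subgroup (GeneralLinearGroup F V)) : Prop :=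
  ∀ W : Submodule F V, Module.finrank F W = 2 →
    ∃ t ∈ G, t ^ p = 1 ∧ (∀ v, t • v = v ↔ v ∈ W) ∧ ∀ v, t • v - v ∈ W

theorem exists_sub_smul_mem [FiniteDimensional F V] (hV : Module.finrank F V = 3)
    {W : Submodule F V} (hW : Module.finrank F W = 2) {z : V} (hz : z ∉ W) (v : V) :
    ∃ c : F, v - c • z ∈ W := by
  have h1 : Module.finrank F (V ⧸ W) = 1 := by
    have := W.finrank_quotient_add_finrank
    omega
  have h2 : W.mkQ z ≠ 0 := by rwa [Ne, Submodule.mkQ_apply, Submodule.Quotient.mk_eq_zero]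
  obtain ⟨c, hc⟩ := (finrank_eq_one_iff_of_nonzero' _ h2).1 h1 (W.mkQ v)
  refine ⟨c, ?_⟩
  rw [← Submodule.Quotient.mk_eq_zero, ← Submodule.mkQ_apply, map_sub, map_smul, hc, sub_self]

theorem exists_pair_of_finrank_two {W : Submodule F V} (hW : Module.finrank F W = 2) :
    ∃ x y : V, LinearIndependent F ![x, y] ∧ W = Submodule.span F {x, y} := by
  have : Module.Finite F W := Module.finite_of_finrank_pos (by omega)
  let b := Module.finBasisOfFinrankEq F W hW
  have h1 : LinearIndependent F ![(b 0 : V), (b 1 : V)] := by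
    have h2 := b.linearIndependent.map' W.subtype W.ker_subtype
    have h4 : ![(b 0 : V), (b 1 : V)] = W.subtype ∘ b := by
      ext i
      fin_cases i <;> rfl
    rw [h4]
    exact h2
  refine ⟨b 0, b 1, h1, ?_⟩
  have h3 := congrArg (Submodule.map W.subtype) b.span_eq
  rw [Submodule.map_span, Submodule.map_top, Submodule.range_subtype, ← Set.range_comp] at h3
  refine h3.symm.trans (congrArg _ ?_)
  ext v
  simp [Fin.exists_fin_two, eq_comm]

theorem finrank_span_pair {x y : V} (h : LinearIndependent F ![x, y]) :
    Module.finrank F (Submodule.span F {x, y}) = 2 := by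
  have := finrank_span_eq_card h
  rwa [Matrix.range_cons, Matrix.range_cons, Matrix.range_empty, Set.union_empty,
    Set.singleton_union, Fintype.card_fin] at this

theorem exists_basis_of_triple (hV : Module.finrank F V = 3) {x y z : V}
    (h : LinearIndependent F ![x, y]) (hz : z ∉ Submodule.span F {x, y}) :
    ∃ b : Module.Basis (Fin 3) F V, b 0 = x ∧ b 1 = y ∧ b 2 = z := by
  have h3 : LinearIndependent F ![z, x, y] := by
    refine linearIndependent_finCons.2 ⟨h, ?_⟩
    rwa [Matrix.range_cons, Matrix.range_cons, Matrix.range_empty, Set.union_empty,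
      Set.singleton_union]
  let b := basisOfLinearIndependentOfCardEqFinrank h3 (by simp [hV])
  refine ⟨b.reindex (finRotate 3).symm, ?_, ?_, ?_⟩ <;> simp [b]

/-- If the stabilizer of no two lines fixes a line outside their plane, then by Maschke's theorem
and Cauchy's theorem every plane is the axis of a transvection. -/
theorem hasTransvections_of_forall_basis [Finite V] (hV : Module.finrank F V = 3) (p : ℕ)
    [Fact p.Prime] [CharP F p] {G : Subgroup (GeneralLinearGroup F V)}
    (hG : ∀ b : Module.Basis (Fin 3) F V, ¬ setStabilizer G (Submodule.span F {b 0} : Set V) ⊓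
            setStabilizer G (Submodule.span F {b 1} : Set V) ≤
          setStabilizer G (Submodule.span F {b 2} : Set V)) :
    HasTransvections p G := by
  intro W hW
  have : FiniteDimensional F V := Module.finite_of_finrank_pos (by omega)
  obtain ⟨x, y, hxy, hWxy⟩ := exists_pair_of_finrank_two hW
  have hxW : x ∈ W := hWxy ▸ Submodule.subset_span (by simp)
  have hyW : y ∈ W := hWxy ▸ Submodule.subset_span (by simp)
  obtain ⟨z, hz⟩ : ∃ z, z ∉ W := by
    by_contra! h
    have : W = ⊤ := eq_top_iff.2 fun v _ => h v
    rw [this, finrank_top, hV] at hW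
    omega
  have hd : p ∣ Nat.card (setStabilizer G (Submodule.span F {x} : Set V) ⊓
      setStabilizer G (Submodule.span F {y} : Set V) : Subgroup (GeneralLinearGroup F V)) := by
    by_contra hd
    obtain ⟨U, hU, hUD⟩ := exists_invariant_isCompl p hd W fun g hg u hu => by
      obtain ⟨-, a, ha⟩ := mem_setStabilizer_span_singleton.1 hg.1
      obtain ⟨-, b, hb⟩ := mem_setStabilizer_span_singleton.1 hg.2
      rw [hWxy, Submodule.mem_span_pair] at hu
      obtain ⟨c, d, rfl⟩ := hu
      rw [smul_add, smul_comm g, smul_comm g, ha, hb]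
      exact W.add_mem (W.smul_mem _ (W.smul_mem _ hxW)) (W.smul_mem _ (W.smul_mem _ hyW))
    have hUb : U ≠ ⊥ := by
      rintro rfl
      exact hz (eq_top_of_isCompl_bot hU ▸ Submodule.mem_top)
    obtain ⟨u, huU, hu0⟩ := U.ne_bot_iff.1 hUb
    have huW : u ∉ W := fun h => hu0 (Submodule.disjoint_def.1 hU.disjoint u h huU)
    obtain ⟨b, rfl, rfl, rfl⟩ := exists_basis_of_triple hV hxy (hWxy ▸ huW)
    refine hG b fun g hg => mem_setStabilizer_span_singleton.2 ⟨hg.1.1, ?_⟩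
    obtain ⟨c, hc⟩ := exists_sub_smul_mem hV hW huW (g • b 2)
    refine ⟨c, sub_eq_zero.1 (Submodule.disjoint_def.1 hU.disjoint _ hc ?_)⟩
    exact U.sub_mem (hUD g hg _ huU) (U.smul_mem _ huU)
  obtain ⟨t, ht, ht1, htp⟩ := exists_pow_char_eq_one_of_dvd hd
  obtain ⟨htG, a, ha⟩ := mem_setStabilizer_span_singleton.1 ht.1
  obtain ⟨-, b, hb⟩ := mem_setStabilizer_span_singleton.1 ht.2
  have htx := smul_eq_self_of_pow_char p htp ha
  have hty := smul_eq_self_of_pow_char p htp hb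
  have htW : ∀ w ∈ W, t • w = w := by
    intro w hw
    rw [hWxy, Submodule.mem_span_pair] at hw
    obtain ⟨c, d, rfl⟩ := hw
    rw [smul_add, smul_comm t, smul_comm t, htx, hty]
  have htz : t • z - z ∈ W := by
    obtain ⟨c, hc⟩ := exists_sub_smul_mem hV hW hz (t • z)
    have := eigenvalue_eq_one_of_pow_char p htp W (fun w hw => by rwa [htW w hw]) hz hc
    rwa [this, one_smul] at hc
  have hsub : ∀ v, ∃ c : F, v - c • z ∈ W ∧ t • v - v = c • (t • z - z) := by
    intro v
    obtain ⟨c, hc⟩ := exists_sub_smul_mem hV hW hz v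
    refine ⟨c, hc, ?_⟩
    have h1 := htW _ hc
    rw [smul_sub, smul_comm t] at h1
    rw [smul_sub, ← sub_eq_zero, ← sub_eq_zero.2 h1]
    abel
  refine ⟨t, htG, htp, fun v => ⟨fun hv => ?_, htW v⟩, fun v => ?_⟩
  · obtain ⟨c, hc, h⟩ := hsub v
    rw [hv, sub_self, eq_comm, smul_eq_zero] at h
    rcases h with h | h
    · rwa [h, zero_smul, sub_zero] at hc
    · exfalso
      refine ht1 (generalLinearGroup_ext fun v => ?_)
      obtain ⟨c, -, h'⟩ := hsub v
      rw [h, smul_zero, sub_eq_zero] at h'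
      rw [h', one_smul]
  · obtain ⟨c, -, h⟩ := hsub v
    rw [h]
    exact W.smul_mem _ htz

theorem exists_finrank_two_notMem [FiniteDimensional F V] (hV : Module.finrank F V = 3) {x : V}
    (hx : x ≠ 0) : ∃ W : Submodule F V, Module.finrank F W = 2 ∧ x ∉ W := by
  obtain ⟨W, hW⟩ := (F ∙ x).exists_isCompl
  refine ⟨W, ?_, fun h => hx ?_⟩
  · have h1 := Submodule.finrank_add_eq_of_isCompl hW
    rw [finrank_span_singleton hx] at h1
    omega
  · exact Submodule.disjoint_def.1 hW.disjoint x (Submodule.mem_span_singleton_self x) h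

theorem eq_bot_or_eq_top_of_finrank_three [FiniteDimensional F V] (hV : Module.finrank F V = 3)
    {U : Submodule F V} (h1 : Module.finrank F U ≠ 1) (h2 : Module.finrank F U ≠ 2) :
    U = ⊥ ∨ U = ⊤ := by
  have h3 := U.finrank_le
  rw [hV] at h3
  have : Module.finrank F U = 0 ∨ Module.finrank F U = 3 := by omega
  rcases this with h | h
  · exact Or.inl (Submodule.finrank_eq_zero.1 h)
  · exact Or.inr (Submodule.eq_top_of_finrank_eq (h.trans hV.symm))

/-- An invariant line cannot lie outside the axis of a transvection. -/
theorem HasTransvections.irreducible [FiniteDimensional F V] (hV : Module.finrank F V = 3) {p : ℕ}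
    [Fact p.Prime] [CharP F p] {G : Subgroup (GeneralLinearGroup F V)}
    (hT : HasTransvections p G)
    (hplane : ∀ W : Submodule F V, Module.finrank F W = 2 → ¬ ∀ g ∈ G, ∀ u ∈ W, g • u ∈ W)
    (U : Submodule F V) (hU : ∀ g ∈ G, ∀ u ∈ U, g • u ∈ U) : U = ⊥ ∨ U = ⊤ := by
  refine eq_bot_or_eq_top_of_finrank_three hV (fun h1 => ?_) fun h2 => hplane U h2 hU
  obtain ⟨⟨x, hxU⟩, hx0, hx⟩ := finrank_eq_one_iff'.1 h1
  have hx0' : x ≠ 0 := fun h => hx0 (Subtype.ext h)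
  obtain ⟨W, hW, hxW⟩ := exists_finrank_two_notMem hV hx0'
  obtain ⟨t, ht, htp, htW, -⟩ := hT W hW
  obtain ⟨a, ha⟩ := hx ⟨t • x, hU t ht x hxU⟩
  exact hxW ((htW x).1 (smul_eq_self_of_pow_char p htp (congrArg Subtype.val ha).symm))

/-! ### Dimension three: the normal `p'`-subgroup is irreducible -/

/-- Three independent eigenvectors of `N`, the third with a character different from the first
two, are incompatible with a transvection whose axis is spanned by the first two. -/
theorem HasTransvections.false_of_eigenvectors {p : ℕ}
    {G N : Subgroup (GeneralLinearGroup F V)}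
    (hT : HasTransvections p G) (hGN : ∀ g ∈ G, ∀ n ∈ N, g * n * g⁻¹ ∈ N) {x y z : V}
    (hxy : LinearIndependent F ![x, y]) (hz : z ∉ Submodule.span F {x, y})
    {a b c : GeneralLinearGroup F V → F} (ha : ∀ n ∈ N, n • x = a n • x)
    (hb : ∀ n ∈ N, n • y = b n • y) (hc : ∀ n ∈ N, n • z = c n • z)
    (hac : ∃ n ∈ N, a n ≠ c n) (hbc : ∃ n ∈ N, b n ≠ c n) : False := by
  obtain ⟨t, ht, htp, htW, htV⟩ := hT _ (finrank_span_pair hxy)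
  obtain ⟨α, β, hw⟩ := Submodule.mem_span_pair.1 (htV z)
  have htz : t • z = z + (α • x + β • y) := by rw [hw, add_sub_cancel]
  have hx0 : x ≠ 0 := hxy.ne_zero 0
  have hy0 : y ≠ 0 := hxy.ne_zero 1
  have key : ∀ n ∈ N, α * (a n - c n) = 0 ∧ β * (b n - c n) = 0 := by
    intro n hn
    have hn' : t⁻¹ * n * t ∈ N := by
      have := hGN _ (G.inv_mem ht) n hn
      rwa [inv_inv] at this
    have h1 : n • t • z = c (t⁻¹ * n * t) • t • z := by
      have h2 : n * t = t * (t⁻¹ * n * t) := by group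
      rw [← mul_smul, h2, mul_smul, hc _ hn', smul_comm t]
    generalize c (t⁻¹ * n * t) = e at h1
    rw [htz, smul_add, smul_add, smul_comm n, smul_comm n, ha n hn, hb n hn, hc n hn] at h1
    have h3 : e = c n := by
      by_contra hne
      refine hz (((Submodule.span F {x, y}).smul_mem_iff (sub_ne_zero.2 hne)).1 ?_)
      refine Submodule.mem_span_pair.2 ⟨α * (a n - e), β * (b n - e), ?_⟩
      linear_combination (norm := module) h1
    subst h3
    obtain ⟨h4, h5⟩ := coeff_eq_of_pair hxy (a := α * (a n - c n)) (b := β * (b n - c n))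
      (c := 0) (d := 0) (by linear_combination (norm := module) h1)
    exact ⟨h4, h5⟩
  obtain ⟨n, hn, hne⟩ := hac
  obtain ⟨m, hm, hme⟩ := hbc
  have hα := (mul_eq_zero.1 (key n hn).1).resolve_right (sub_ne_zero.2 hne)
  have hβ := (mul_eq_zero.1 (key m hm).2).resolve_right (sub_ne_zero.2 hme)
  refine hz ((htW z).1 ?_)
  rw [htz, hα, hβ, zero_smul, zero_smul, add_zero, add_zero]

/-- Clifford's theorem in this situation: the eigenvectors of `N` span a `G`-invariant subspace;
if there were any, `N` would be diagonal with at least two different characters. -/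
theorem HasTransvections.forall_exists_smul_ne [FiniteDimensional F V] [Nontrivial V]
    (hV : Module.finrank F V = 3) {p : ℕ} {G N : Subgroup (GeneralLinearGroup F V)}
    (hT : HasTransvections p G)
    (hirr : ∀ U : Submodule F V, (∀ g ∈ G, ∀ u ∈ U, g • u ∈ U) → U = ⊥ ∨ U = ⊤)
    (hGN : ∀ g ∈ G, ∀ n ∈ N, g * n * g⁻¹ ∈ N) (hNZ : ¬ N ≤ scalarGroup F V) {v : V}
    (hv : v ≠ 0) : ∃ n ∈ N, ∀ a : F, n • v ≠ a • v := by
  by_contra! H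
  let S : Set V := {u | ∀ n ∈ N, ∃ a : F, n • u = a • u}
  have hvS : v ∈ S := H
  have hSG : ∀ g ∈ G, ∀ u ∈ S, g • u ∈ S := by
    intro g hg u hu n hn
    have hn' : g⁻¹ * n * g ∈ N := by
      have := hGN _ (G.inv_mem hg) n hn
      rwa [inv_inv] at this
    obtain ⟨a, ha⟩ := hu _ hn'
    have h2 : n * g = g * (g⁻¹ * n * g) := by group
    exact ⟨a, by rw [← mul_smul, h2, mul_smul, ha, smul_comm g]⟩
  have hspan : Submodule.span F S = ⊤ := by
    refine (hirr (Submodule.span F S) fun g hg u hu => ?_).resolve_left fun h => ?_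
    · induction hu using Submodule.span_induction with
      | mem u hu => exact Submodule.subset_span (hSG g hg u hu)
      | zero => rw [smul_zero]; exact Submodule.zero_mem _
      | add u w _ _ hu hw => rw [smul_add]; exact Submodule.add_mem _ hu hw
      | smul a u _ hu => rw [smul_comm]; exact Submodule.smul_mem _ _ hu
    · have := Submodule.subset_span (R := F) hvS
      rw [h] at this
      exact hv this
  have hout : ∀ U : Submodule F V, Module.finrank F U ≠ 3 → ∃ u ∈ S, u ∉ U := by
    intro U hU
    by_contra! h
    have h1 : U = ⊤ := top_le_iff.1 (hspan ▸ Submodule.span_le.2 h)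
    rw [h1, finrank_top] at hU
    exact hU hV
  obtain ⟨y, hyS, hy⟩ := hout (F ∙ v) (by rw [finrank_span_singleton hv]; omega)
  have hvy := linearIndependent_pair_of_notMem (Submodule.mem_span_singleton_self v) hv hy
  obtain ⟨z, hzS, hz⟩ := hout (Submodule.span F {v, y}) (by rw [finrank_span_pair hvy]; omega)
  obtain ⟨e, he0, he1, he2⟩ := exists_basis_of_triple hV hvy hz
  have hind : ∀ i j : Fin 3, i ≠ j → LinearIndependent F ![e i, e j] := by
    intro i j hij
    have := e.linearIndependent.comp ![i, j] (by
      intro k l hkl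
      fin_cases k <;> fin_cases l <;> simp_all)
    convert this using 1
    ext k
    fin_cases k <;> rfl
  have hnotin : ∀ i j k : Fin 3, i ≠ k → j ≠ k → e k ∉ Submodule.span F {e i, e j} := by
    intro i j k hik hjk hmem
    have := e.linearIndependent.notMem_span_image (s := {i, j}) (x := k) (by
      simp [hik.symm, hjk.symm])
    rw [Set.image_pair] at this
    exact this hmem
  have heS : ∀ i, e i ∈ S := by
    intro i
    fin_cases i
    · exact he0 ▸ hvS
    · exact he1 ▸ hyS
    · exact he2 ▸ hzS
  have hex : ∀ i, ∃ a : GeneralLinearGroup F V → F, ∀ n ∈ N, n • e i = a n • e i := by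
    intro i
    choose! a ha using heS i
    exact ⟨a, ha⟩
  choose χ hχ using hex
  have hfin : ∀ i j k : Fin 3, i ≠ j → i ≠ k → j ≠ k → (∀ n ∈ N, χ i n = χ k n) ∨
      ∀ n ∈ N, χ j n = χ k n := by
    intro i j k hij hik hjk
    by_contra! h
    exact hT.false_of_eigenvectors hGN (hind i j hij) (hnotin i j k hik hjk) (hχ i) (hχ j) (hχ k)
      h.1 h.2
  have heq : ∀ n ∈ N, χ 0 n = χ 1 n ∧ χ 0 n = χ 2 n := by
    have h1 := hfin 0 1 2 (by decide) (by decide) (by decide)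
    have h2 := hfin 0 2 1 (by decide) (by decide) (by decide)
    have h3 := hfin 1 2 0 (by decide) (by decide) (by decide)
    intro n hn
    rcases h1 with h1 | h1 <;> rcases h2 with h2 | h2 <;> rcases h3 with h3 | h3 <;>
      have := h1 n hn <;> have := h2 n hn <;> have := h3 n hn <;> grind
  refine hNZ fun n hn => mem_scalarGroup_of_forall (a := χ 0 n) fun u => ?_
  conv_lhs => rw [← e.sum_repr u]
  conv_rhs => rw [← e.sum_repr u]
  simp only [Fin.sum_univ_three, smul_add, smul_comm n, hχ _ n hn, ← (heq n hn).1,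
    ← (heq n hn).2]
  simp only [smul_comm (χ 0 n)]

theorem HasTransvections.irreducible_of_normal [Finite V] [Nontrivial V]
    (hV : Module.finrank F V = 3) {p : ℕ} [CharP F p] {G N : Subgroup (GeneralLinearGroup F V)}
    (hT : HasTransvections p G)
    (hirr : ∀ U : Submodule F V, (∀ g ∈ G, ∀ u ∈ U, g • u ∈ U) → U = ⊥ ∨ U = ⊤)
    (hGN : ∀ g ∈ G, ∀ n ∈ N, g * n * g⁻¹ ∈ N) (hNZ : ¬ N ≤ scalarGroup F V)
    (hN : ¬ p ∣ Nat.card N) (U : Submodule F V) (hU : ∀ n ∈ N, ∀ u ∈ U, n • u ∈ U) :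
    U = ⊥ ∨ U = ⊤ := by
  have : FiniteDimensional F V := Module.finite_of_finrank_pos (by omega)
  have hline : ∀ L : Submodule F V, (∀ n ∈ N, ∀ u ∈ L, n • u ∈ L) → Module.finrank F L ≠ 1 := by
    intro L hL h1
    obtain ⟨⟨x, hxL⟩, hx0, hx⟩ := finrank_eq_one_iff'.1 h1
    obtain ⟨n, hn, h⟩ := hT.forall_exists_smul_ne hV hirr hGN hNZ
      (v := x) (fun h => hx0 (Subtype.ext h))
    obtain ⟨a, ha⟩ := hx ⟨n • x, hL n hn x hxL⟩
    exact h a (congrArg Subtype.val ha).symm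
  refine eq_bot_or_eq_top_of_finrank_three hV (hline U hU) fun h2 => ?_
  obtain ⟨L, hUL, hL⟩ := exists_invariant_isCompl p hN U hU
  refine hline L hL ?_
  have := Submodule.finrank_add_eq_of_isCompl hUL
  omega

/-! ### Dimension three: primes of `q² + q + 1` -/

theorem card_pow_finrank_modEq [Finite F] [Finite V] (r : ℕ) [Fact r.Prime]
    {C : Subgroup (GeneralLinearGroup F V)} (hC : IsPGroup r C) (U : Submodule F V)
    (hU : ∀ n ∈ C, ∀ u ∈ U, n • u ∈ U) :
    Nat.card F ^ Module.finrank F U ≡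
      Nat.card F ^ Module.finrank F (U ⊓ fixedVectors C : Submodule F V) [MOD r] := by
  let act : MulAction C U :=
    { smul := fun n u => ⟨n • (u : V), hU n n.2 u u.2⟩
      one_smul := fun u => Subtype.ext (one_smul C (u : V))
      mul_smul := fun a b u => Subtype.ext (mul_smul a b (u : V)) }
  have h := hC.card_modEq_card_fixedPoints U
  have e : MulAction.fixedPoints C U ≃ (U ⊓ fixedVectors C : Submodule F V) :=
    { toFun := fun u => ⟨u.1.1, u.1.2, fun n hn => congrArg Subtype.val (u.2 ⟨n, hn⟩)⟩
      invFun := fun u => ⟨⟨u.1, u.2.1⟩, fun n => Subtype.ext (u.2.2 n n.2)⟩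
      left_inv := fun u => rfl
      right_inv := fun u => rfl }
  rwa [Nat.card_congr e, Module.natCard_eq_pow_finrank (K := F) (V := U),
    Module.natCard_eq_pow_finrank (K := F) (V := (U ⊓ fixedVectors C : Submodule F V))] at h

/-- A transvection cannot normalize a commutative irreducible group `C`: for `n ∈ C` choose
`w` with `w` and `n w` in the axis; then `t n t⁻¹` and `n` agree on `w`, hence are equal. So `t`
centralizes `C` and its axis is invariant under `C`. -/
theorem false_of_commutative_irreducible [FiniteDimensional F V] (hV : Module.finrank F V = 3)
    {t : GeneralLinearGroup F V} {W : Submodule F V} (hW : Module.finrank F W = 2)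
    (htW : ∀ v, t • v = v ↔ v ∈ W) {C : Subgroup (GeneralLinearGroup F V)}
    (hcomm : ∀ a ∈ C, ∀ b ∈ C, a * b = b * a) (htC : ∀ a ∈ C, t * a * t⁻¹ ∈ C)
    (hirr : ∀ U : Submodule F V, (∀ n ∈ C, ∀ u ∈ U, n • u ∈ U) → U = ⊥ ∨ U = ⊤) : False := by
  have hcent : ∀ n ∈ C, t * n * t⁻¹ = n := by
    intro n hn
    obtain ⟨w, hw, hnw, hw0⟩ : ∃ w ∈ W, n • w ∈ W ∧ w ≠ 0 := by
      by_contra! h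
      let e := (LinearMap.GeneralLinearGroup.generalLinearEquiv F V n).symm
      have hinf : W ⊓ W.map (e : V →ₗ[F] V) = ⊥ :=
        (Submodule.eq_bot_iff _).2 fun w hw => h w hw.1 ((Submodule.mem_map_equiv W).1 hw.2)
      have h1 := Submodule.finrank_sup_add_finrank_inf_eq W (W.map (e : V →ₗ[F] V))
      have h2 := LinearEquiv.finrank_map_eq e W
      have h3 := (W ⊔ W.map (e : V →ₗ[F] V)).finrank_le
      rw [hinf, finrank_bot] at h1
      omega
    have h1 : (t * n * t⁻¹) • w = n • w := by
      have h2 : t⁻¹ • w = w := by rw [inv_smul_eq_iff, (htW w).2 hw]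
      rw [mul_smul, mul_smul, h2, (htW _).2 hnw]
    have hmC : n⁻¹ * (t * n * t⁻¹) ∈ C := C.mul_mem (C.inv_mem hn) (htC n hn)
    let U := fixedVectors (Subgroup.zpowers (n⁻¹ * (t * n * t⁻¹)))
    have hUmem : ∀ u, u ∈ U ↔ (n⁻¹ * (t * n * t⁻¹)) • u = u := by
      intro u
      refine ⟨fun h => h _ (Subgroup.mem_zpowers _), fun h => ?_⟩
      rintro _ ⟨k, rfl⟩
      exact Subgroup.zpow_mem (MulAction.stabilizer (GeneralLinearGroup F V) u)
        (MulAction.mem_stabilizer_iff.2 h) k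
    have hU := hirr U fun g hg u hu => by
      rw [hUmem] at hu ⊢
      rw [← mul_smul, hcomm _ hmC g hg, mul_smul, hu]
    have hwU : w ∈ U := by
      rw [hUmem, mul_smul, h1, inv_smul_smul]
    rcases hU with hU | hU
    · rw [hU, Submodule.mem_bot] at hwU
      exact absurd hwU hw0
    · have h4 : n⁻¹ * (t * n * t⁻¹) = 1 := generalLinearGroup_ext fun v => by
        rw [one_smul, (hUmem v).1 (hU ▸ Submodule.mem_top)]
      exact (inv_mul_eq_one.1 h4).symm
  rcases hirr W fun n hn u hu => by
    rw [← htW, ← mul_smul]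
    have : t * n = n * t := by rw [← mul_inv_eq_iff_eq_mul, hcent n hn]
    rw [this, mul_smul, (htW u).2 hu] with h | h
  · rw [h, finrank_bot] at hW
    omega
  · rw [h, finrank_top] at hW
    omega

/-- A prime `r` dividing `q³ - 1` but neither `q - 1` nor `q² - 1` does not divide `|N|`: all
nontrivial `r`-subgroups are irreducible, and a transvection would normalize a commutative one. -/
theorem HasTransvections.not_dvd_card [Finite F] [Finite V] (hV : Module.finrank F V = 3)
    {p r : ℕ} [Fact p.Prime] [Fact r.Prime] {G N : Subgroup (GeneralLinearGroup F V)}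
    (hT : HasTransvections p G) (hGN : ∀ g ∈ G, ∀ n ∈ N, g * n * g⁻¹ ∈ N)
    (hN : ¬ p ∣ Nat.card N) (h1 : ¬ Nat.card F ≡ 1 [MOD r]) (h2 : ¬ Nat.card F ^ 2 ≡ 1 [MOD r])
    (h3 : Nat.card F ^ 3 ≡ 1 [MOD r]) : ¬ r ∣ Nat.card N := by
  intro hr
  have : FiniteDimensional F V := Module.finite_of_finrank_pos (by omega)
  have : Nontrivial V := Module.nontrivial_of_finrank_pos (R := F) (by omega)
  obtain ⟨x, hx⟩ := exists_ne (0 : V)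
  obtain ⟨W, hW, -⟩ := exists_finrank_two_notMem hV hx
  obtain ⟨t, ht, htp, htW, -⟩ := hT W hW
  have htN : t ∈ Subgroup.normalizer (N : Set (GeneralLinearGroup F V)) := by
    refine Subgroup.mem_normalizer_iff.2 fun n => ⟨hGN t ht n, fun h => ?_⟩
    have := hGN _ (G.inv_mem ht) _ h
    convert this using 1
    group
  obtain ⟨C, hC, hCr, hCc, hCt⟩ := exists_commutative_isPGroup_of_coprime hN hr
    (φ := N.normalizerMonoidHom ⟨t, htN⟩) (by
      have : (⟨t, htN⟩ : Subgroup.normalizer (N : Set (GeneralLinearGroup F V))) ^ p = 1 :=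
        Subtype.ext htp
      rw [← map_pow, this, map_one])
  have hCr' : IsPGroup r (C.map N.subtype) := hCr.map _
  have hfix : fixedVectors (C.map N.subtype) = ⊥ := by
    have h := card_pow_finrank_modEq r hCr' ⊤ fun n _ u _ => Submodule.mem_top
    rw [finrank_top, hV, top_inf_eq] at h
    have h' := h.symm.trans h3
    have hle := (fixedVectors (C.map N.subtype)).finrank_le
    rw [hV] at hle
    refine (eq_bot_or_eq_top_of_finrank_three hV (fun h4 => ?_) fun h4 => ?_).resolve_right
      fun h4 => hC ?_
    · rw [h4, pow_one] at h'
      exact h1 h'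
    · rw [h4] at h'
      exact h2 h'
    · rw [Subgroup.eq_bot_iff_forall]
      intro n hn
      refine Subtype.ext (generalLinearGroup_ext fun v => ?_)
      have hv : v ∈ fixedVectors (C.map N.subtype) := h4 ▸ Submodule.mem_top
      exact (hv n ⟨n, hn, rfl⟩).trans (one_smul _ v).symm
  refine false_of_commutative_irreducible hV hW htW (C := C.map N.subtype) ?_ ?_ fun U hU => ?_
  · rintro _ ⟨a, ha, rfl⟩ _ ⟨b, hb, rfl⟩
    exact congrArg Subtype.val (hCc a ha b hb)
  · rintro _ ⟨a, ha, rfl⟩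
    exact ⟨_, hCt a ha, rfl⟩
  · have h := card_pow_finrank_modEq r hCr' U hU
    rw [hfix, inf_bot_eq, finrank_bot, pow_zero] at h
    refine eq_bot_or_eq_top_of_finrank_three hV (fun h4 => ?_) fun h4 => ?_
    · rw [h4, pow_one] at h
      exact h1 h
    · rw [h4] at h
      exact h2 h

/-! ### Dimension three: orbits of `N` on points -/

theorem card_generalLinearGroup_of_finrank_three [Finite F] (hV : Module.finrank F V = 3) :
    Nat.card (GeneralLinearGroup F V) = (Nat.card F ^ 3 - 1) * (Nat.card F ^ 3 - Nat.card F) *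
      (Nat.card F ^ 3 - Nat.card F ^ 2) := by
  have := Fintype.ofFinite F
  have : FiniteDimensional F V := Module.finite_of_finrank_pos (by omega)
  let b := Module.finBasisOfFinrankEq F V hV
  rw [Nat.card_congr ((LinearMap.GeneralLinearGroup.congrLinearEquiv b.equivFun).toEquiv.trans
    (Matrix.GeneralLinearGroup.toLin (n := Fin 3) (R := F)).toEquiv.symm), Matrix.card_GL_field]
  simp [Fin.prod_univ_three]

theorem exists_card_orbit_eq_one_or_three {N X : Type*} [Group N] [Finite N] [Finite X]
    [MulAction N X] (hX : Nat.card X = 21) (hN : Nat.card N ∣ 181440) (h2 : ¬ 2 ∣ Nat.card N)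
    (h7 : ¬ 7 ∣ Nat.card N) :
    ∃ x : X, Nat.card (MulAction.orbit N x) = 1 ∨ Nat.card (MulAction.orbit N x) = 3 := by
  by_contra! H
  have hdvd : ∀ x : X, Nat.card (MulAction.orbit N x) ∣ Nat.card N := fun x => by
    rw [Nat.card_coe_set_eq, ← MulAction.index_stabilizer]
    exact Subgroup.index_dvd_card _
  have hle : ∀ x : X, Nat.card (MulAction.orbit N x) ≤ 21 := fun x => by
    rw [← hX]
    exact Nat.card_le_card_of_injective _ Subtype.val_injective
  have h5 : ∀ x : X, Nat.card (MulAction.orbit N x) = 5 ∨ Nat.card (MulAction.orbit N x) = 9 ∨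
      Nat.card (MulAction.orbit N x) = 15 := by
    intro x
    have e1 := hdvd x
    have e2 := hle x
    have e3 := H x
    generalize Nat.card (MulAction.orbit N x) = s at *
    have e4 : s ∣ 181440 := e1.trans hN
    have e5 : ¬ 2 ∣ s := fun h => h2 (h.trans e1)
    have e6 : ¬ 7 ∣ s := fun h => h7 (h.trans e1)
    interval_cases s <;> omega
  have := Fintype.ofFinite (MulAction.orbitRel.Quotient N X)
  have hsum := Nat.card_congr (MulAction.selfEquivSigmaOrbits N X)
  rw [hX, Nat.card_sigma] at hsum
  have hrep : ∀ S : Finset (MulAction.orbitRel.Quotient N X), ∃ a b c : ℕ,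
      ∑ ω ∈ S, Nat.card (MulAction.orbit N ω.out) = 5 * a + 9 * b + 15 * c := by
    classical
    intro S
    induction S using Finset.induction_on with
    | empty => exact ⟨0, 0, 0, by simp⟩
    | insert ω S hω ih =>
      obtain ⟨a, b, c, h⟩ := ih
      rw [Finset.sum_insert hω, h]
      rcases h5 ω.out with h | h | h <;> rw [h]
      · exact ⟨a + 1, b, c, by ring⟩
      · exact ⟨a, b + 1, c, by ring⟩
      · exact ⟨a, b, c + 1, by ring⟩
  obtain ⟨a, b, c, h⟩ := hrep Finset.univ
  have h21 : 21 = 5 * a + 9 * b + 15 * c := hsum.trans h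
  have : b ≤ 2 := by omega
  interval_cases b <;> omega

open scoped LinearAlgebra.Projectivization

theorem exists_smul_rep_eq {g : GeneralLinearGroup F V} {D E : ℙ F V} (h : g • D = E) :
    ∃ a : F, g • D.rep = a • E.rep := by
  rw [← D.mk_rep, Projectivization.smul_mk, ← E.mk_rep, Projectivization.mk_eq_mk_iff'] at h
  obtain ⟨a, ha⟩ := h
  exact ⟨a, ha.symm⟩

theorem smul_eq_of_smul_rep_eq {g : GeneralLinearGroup F V} {D : ℙ F V}
    (h : g • D.rep = D.rep) : g • D = D := by
  conv_lhs => rw [← D.mk_rep, Projectivization.smul_mk]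
  conv_rhs => rw [← D.mk_rep]
  rw [Projectivization.mk_eq_mk_iff']
  exact ⟨1, by rw [one_smul, h]⟩

/-- If `N` permutes three points, these span `V`. The transvection whose axis contains two of them
maps the orbit to itself, so it fixes the third. -/
theorem HasTransvections.card_orbit_ne_three (hV : Module.finrank F V = 3) {p : ℕ}
    [Fact p.Prime] [CharP F p] {G N : Subgroup (GeneralLinearGroup F V)}
    (hT : HasTransvections p G) (hGN : ∀ g ∈ G, ∀ n ∈ N, g * n * g⁻¹ ∈ N)
    (hirr : ∀ U : Submodule F V, (∀ n ∈ N, ∀ u ∈ U, n • u ∈ U) → U = ⊥ ∨ U = ⊤) (D : ℙ F V) :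
    Nat.card (MulAction.orbit N D) ≠ 3 := by
  intro h
  rw [Nat.card_coe_set_eq, Set.ncard_eq_three] at h
  obtain ⟨A, B, C, hAB, hAC, hBC, hO⟩ := h
  have hAO : A ∈ MulAction.orbit N D := by rw [hO]; simp
  have hBO : B ∈ MulAction.orbit N D := by rw [hO]; simp
  have hCO : C ∈ MulAction.orbit N D := by rw [hO]; simp
  have hstep : ∀ n ∈ N, ∀ E ∈ MulAction.orbit N D, n • E ∈ MulAction.orbit N D := by
    rintro n hn _ ⟨m, rfl⟩
    exact ⟨⟨n, hn⟩ * m, mul_smul (⟨n, hn⟩ : N) m D⟩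
  have hspan : Submodule.span F {A.rep, B.rep, C.rep} = ⊤ := by
    refine (hirr _ fun n hn u hu => ?_).resolve_left fun h => A.rep_nonzero ?_
    · have hE : ∀ E ∈ MulAction.orbit N D,
          n • E.rep ∈ Submodule.span F {A.rep, B.rep, C.rep} := by
        intro E hE
        have h1 := hstep n hn E hE
        obtain ⟨a, ha⟩ := exists_smul_rep_eq (g := n) (D := E) rfl
        rw [ha]
        refine Submodule.smul_mem _ _ (Submodule.subset_span ?_)
        rw [hO] at h1
        rcases h1 with h1 | h1 | h1 <;> rw [h1] <;> simp
      induction hu using Submodule.span_induction with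
      | mem u hu =>
        rcases hu with rfl | rfl | rfl
        · exact hE A hAO
        · exact hE B hBO
        · exact hE C hCO
      | zero => rw [smul_zero]; exact Submodule.zero_mem _
      | add u w _ _ hu hw => rw [smul_add]; exact Submodule.add_mem _ hu hw
      | smul a u _ hu => rw [smul_comm]; exact Submodule.smul_mem _ _ hu
    · have := Submodule.subset_span (R := F) (s := {A.rep, B.rep, C.rep})
        (Set.mem_insert A.rep _)
      rw [h] at this
      exact this
  have hind : LinearIndependent F ![A.rep, B.rep] :=
    Projectivization.linearIndependent_pair_iff_ne.2 hAB
  have hC : C.rep ∉ Submodule.span F {A.rep, B.rep} := by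
    intro h
    have h1 : Submodule.span F {A.rep, B.rep} = ⊤ := by
      rw [← top_le_iff, ← hspan, Submodule.span_le]
      rintro u (rfl | rfl | rfl)
      · exact Submodule.subset_span (by simp)
      · exact Submodule.subset_span (by simp)
      · exact h
    have h2 := finrank_span_pair hind
    rw [h1, finrank_top] at h2
    omega
  obtain ⟨t, ht, htp, htW, -⟩ := hT _ (finrank_span_pair hind)
  have htA : t • A = A := smul_eq_of_smul_rep_eq ((htW _).2 (Submodule.subset_span (by simp)))
  have htB : t • B = B := smul_eq_of_smul_rep_eq ((htW _).2 (Submodule.subset_span (by simp)))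
  have htC : t • C ∈ MulAction.orbit N D := by
    rw [← MulAction.orbit_eq_iff.2 hAO] at hCO
    obtain ⟨n, rfl⟩ := hCO
    have h1 : t • n • A = (t * (n : GeneralLinearGroup F V) * t⁻¹) • t • A := by
      rw [smul_smul _ t, inv_mul_cancel_right, mul_smul]
      rfl
    rw [h1, htA]
    exact hstep _ (hGN t ht n n.2) A hAO
  rw [hO] at htC
  rcases htC with h | h | h
  · exact hAC (smul_left_cancel t (h.trans htA.symm)).symm
  · exact hBC (smul_left_cancel t (h.trans htB.symm)).symm
  · obtain ⟨a, ha⟩ := exists_smul_rep_eq (g := t) h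
    exact hC ((htW _).1 (smul_eq_self_of_pow_char p htp ha))

theorem exists_basis_of_finrank_three [Finite F] [Finite V] (hV : Module.finrank F V = 3)
    (hF : Nat.card F = 3 ∨ Nat.card F = 4) (p : ℕ) [Fact p.Prime] [CharP F p]
    {G : Subgroup (GeneralLinearGroup F V)} (hZG : scalarGroup F V ≤ G) (hG : IsPSolvable p G) :
    (∃ b : Module.Basis (Fin 3) F V,
        setStabilizer G (Submodule.span F {b 0} : Set V) ⊓
            setStabilizer G (Submodule.span F {b 1} : Set V) ≤
          setStabilizer G (Submodule.span F {b 2} : Set V)) ∨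
      (∃ b : Module.Basis (Fin 3) F V,
        setStabilizer G (Submodule.span F {b 1, b 2} : Set V) = G) := by
  by_contra! H
  obtain ⟨H1, H2⟩ := H
  have : FiniteDimensional F V := Module.finite_of_finrank_pos (by omega)
  have : Nontrivial V := Module.nontrivial_of_finrank_pos (R := F) (by omega)
  have hT := hasTransvections_of_forall_basis hV p H1
  have hplane : ∀ W : Submodule F V, Module.finrank F W = 2 →
      ¬ ∀ g ∈ G, ∀ u ∈ W, g • u ∈ W := by
    intro W hW hinv
    obtain ⟨x, y, hxy, hWxy⟩ := exists_pair_of_finrank_two hW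
    obtain ⟨z, hz⟩ : ∃ z, z ∉ W := by
      by_contra! h
      have : W = ⊤ := eq_top_iff.2 fun v _ => h v
      rw [this, finrank_top, hV] at hW
      omega
    obtain ⟨b, hb0, hb1, hb2⟩ := exists_basis_of_triple hV hxy (hWxy ▸ hz)
    refine H2 (b.reindex (finRotate 3)) ?_
    have h1 : (b.reindex (finRotate 3)) 1 = x := by simpa using hb0
    have h2 : (b.reindex (finRotate 3)) 2 = y := by simpa using hb1
    rw [h1, h2, ← hWxy]
    exact le_antisymm (fun g hg => hg.1) fun g hg => ⟨hg, hinv g hg⟩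
  have hirr := hT.irreducible hV hplane
  obtain ⟨x, hx⟩ := exists_ne (0 : V)
  have hGZ : ¬ G ≤ scalarGroup F V := by
    intro hle
    obtain ⟨W, hW, hxW⟩ := exists_finrank_two_notMem hV hx
    exact hplane W hW fun g hg u hu => smul_mem_of_scalarGroup (hle hg) W hu
  obtain ⟨N, -, -, hGN, hNZ, hN⟩ := exists_normal_not_dvd_card p hZG hG hGZ hirr
  have hNirr := hT.irreducible_of_normal hV hirr hGN hNZ hN
  have hfix : ∀ D : ℙ F V, ¬ ∀ n : N, n • D = D := by
    intro D hD
    obtain ⟨n, hn, h⟩ := hT.forall_exists_smul_ne hV hirr hGN hNZ D.rep_nonzero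
    obtain ⟨a, ha⟩ := exists_smul_rep_eq (g := n) (hD ⟨n, hn⟩)
    exact h a ha
  have hcard := Projectivization.card_of_finrank F V hV
  have hGL := card_generalLinearGroup_of_finrank_three (F := F) (V := V) hV
  have hNGL := Subgroup.card_subgroup_dvd_card N
  have hp : p.Prime := Fact.out
  have hpF : p ∣ Nat.card F := by
    have := Fintype.ofFinite F
    rw [← CharP.cast_eq_zero_iff F p, Nat.card_eq_fintype_card, FiniteField.cast_card_eq_zero]
  rcases hF with hF | hF
  · -- `|ℙ| = 13`, and the only prime that can divide `|N|` is `2`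
    obtain rfl : p = 3 := (Nat.prime_dvd_prime_iff_eq hp Nat.prime_three).1 (hF ▸ hpF)
    have : Fact (Nat.Prime 13) := ⟨by norm_num⟩
    have : Fact (Nat.Prime 2) := ⟨Nat.prime_two⟩
    have h13 : ¬ 13 ∣ Nat.card N := hT.not_dvd_card hV hGN hN
      (by rw [hF]; decide) (by rw [hF]; decide) (by rw [hF]; decide)
    have hN2 : IsPGroup 2 N := by
      rw [IsPGroup.iff_card]
      refine ⟨_, Nat.eq_prime_pow_of_unique_prime_dvd Nat.card_pos.ne' fun {d} hd hdN => ?_⟩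
      have hd' : d ∣ 2 ^ 5 * 3 ^ 3 * 13 := by
        have := hdN.trans hNGL
        rw [hGL, hF] at this
        exact this
      rcases hd.dvd_mul.1 hd' with h | h
      · rcases hd.dvd_mul.1 h with h | h
        · exact (Nat.prime_dvd_prime_iff_eq hd Nat.prime_two).1 (hd.dvd_of_dvd_pow h)
        · rw [(Nat.prime_dvd_prime_iff_eq hd Nat.prime_three).1 (hd.dvd_of_dvd_pow h)] at hdN
          exact absurd hdN hN
      · rw [(Nat.prime_dvd_prime_iff_eq hd (by norm_num)).1 h] at hdN
        exact absurd hdN h13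
    obtain ⟨D, hD⟩ := hN2.nonempty_fixed_point_of_prime_not_dvd_card (ℙ F V) (by
      rw [hcard, hF]; decide)
    exact hfix D hD
  · -- `|ℙ| = 21`, and `|N|` divides the odd part of `|GL₃(4)|`
    obtain rfl : p = 2 := (Nat.prime_dvd_prime_iff_eq hp Nat.prime_two).1
      (hp.dvd_of_dvd_pow (n := 2) (by rw [hF] at hpF; exact hpF))
    have : Fact (Nat.Prime 7) := ⟨by norm_num⟩
    have h7 : ¬ 7 ∣ Nat.card N := hT.not_dvd_card hV hGN hN
      (by rw [hF]; decide) (by rw [hF]; decide) (by rw [hF]; decide)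
    obtain ⟨D, hD | hD⟩ := exists_card_orbit_eq_one_or_three (N := N) (X := ℙ F V)
      (by rw [hcard, hF]; decide) (by rw [hGL, hF] at hNGL; exact hNGL) hN h7
    · refine hfix D fun n => ?_
      have h1 := (Nat.card_eq_one_iff_unique.1 hD).1
      exact congrArg Subtype.val (h1.elim ⟨n • D, MulAction.mem_orbit D n⟩
        ⟨D, MulAction.mem_orbit_self D⟩)
    · exact hT.card_orbit_ne_three hV hGN hNirr D hD

end LinearGroups

theorem theorem3p1 {F V : Type*} [Field F] [Finite F] [AddCommGroup V] [Module F V] [Finite V]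
    (p : ℕ) [CharP F p] (G : Subgroup (LinearMap.GeneralLinearGroup F V))
    (hZG : scalarGroup F V ≤ G) (hG : IsPSolvable p G) :
    (Module.finrank F V = 2 → 5 ≤ Nat.card F →
      (∃ b : Module.Basis (Fin 2) F V,
        setStabilizer G (Submodule.span F {b 0} : Set V) ≤
          setStabilizer G (Submodule.span F {b 1} : Set V)) ∨
      (p = 2 ∧ ∃ b : Module.Basis (Fin 2) F V,
        (∃ C : Subgroup (LinearMap.GeneralLinearGroup F V), Nat.card C = 2 ∧
          IsInternalDirectProduct (setStabilizer G (Submodule.span F {b 0} : Set V))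
            (scalarGroup F V) C) ∧
        ∀ g ∈ setStabilizer G (Submodule.span F {b 0} : Set V), orderOf g = 2 →
          (g : Module.End F V) (b 0) = b 0 ∧ (g : Module.End F V) (b 1) = b 1 + b 0)) ∧
    (Module.finrank F V = 3 → (Nat.card F = 3 ∨ Nat.card F = 4) →
      (∃ b : Module.Basis (Fin 3) F V,
        setStabilizer G (Submodule.span F {b 0} : Set V) ⊓
            setStabilizer G (Submodule.span F {b 1} : Set V) ≤
          setStabilizer G (Submodule.span F {b 2} : Set V)) ∨
      (∃ b : Module.Basis (Fin 3) F V,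
        setStabilizer G (Submodule.span F {b 1, b 2} : Set V) = G)) := by
  have : Fact p.Prime := ⟨CharP.char_is_prime F p⟩
  exact ⟨fun hV hF => exists_basis_of_finrank_two hV hF p hZG hG,
    fun hV hF => exists_basis_of_finrank_three hV hF p hZG hG⟩
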